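/- **Theorem 3.2.** For an integer $N\ge 1$ let $V_N=\{-N,\dots,0,\dots,N\}$. For $\alpha\in[0,\infty)$ let $\hat\pi_\alpha$ and $\check\pi_\alpha$ be the probability measures on $V_N$ with $$\hat\pi_\alpha(x)\propto (N-|x|+1)^\alpha,\qquad \check\pi_\alpha(x)\propto(|x|+1)^\alpha .$$ Let $R$ be the symmetric simple random walk on $V_N$ with $R(x,y)=1/3$ if $|x-y|=1$, holding probability $R(x,x)=1/3$ for $|x|<N$ and $R(\pm N,\pm N)=2/3$. Let $\hat M_\alpha$ (resp. $\check M_\alpha$) be the Metropolis chain with base $R$ and target $\pi=\hat\pi_\alpha$ (resp. $\pi=\check\pi_\alpha$), that is, the Markov kernel with $M(x,y)=R(x,y)\min\{1,\pi(y)/\pi(x)\}$ for $y\ne x$ and $M(x,x)=1-\sum_{y\neq x}M(x,y)$. For a kernel $Q$ on $V_N$ and $\varepsilon\ge0$ let $\mathcal Q_N(Q,\varepsilon)=\{Q+\Delta_s: s\in[-\varepsilon,\varepsilon]\}$, where $\Delta_s(0,1)=s$, $\Delta_s(0,-1)=-s$ and $\Delta_s(x,y)=0$ otherwise. Set $\hat\varepsilon_{N,\alpha}=\frac16\left(\frac{N}{N+1}\right)^\alpha$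 and $\check\varepsilon_{N,\alpha}=\frac16$. For a sequence $(K_i)_{i\ge1}$ of Markov kernels on $V_N$ let $K_{0,n}=K_1K_2\cdots K_n$ (with $K_{0,0}=I$), and for $\eta>0$ let $$T_\infty(\eta)=\inf\Bigl\{n\ge0:\ \max_{x,y,z\in V_N}\Bigl|\frac{K_{0,n}(x,z)}{K_{0,n}(y,z)}-1\Bigr|<\eta\Bigr\},$$ with the conventions $0/0=1$, $a/0=\infty$ for $a>0$, and $\inf\emptyset=\infty$. Write $\log_+ t=\max\{0,\log t\}$. Fix $\alpha\in[0,\infty)$. 1. There is a constant $A\in(0,\infty)$, depending only on $\alpha$, such that for all $N\ge1$, every sequence $(K_i)_{i\ge1}$ with $K_i\in\mathcal Q_N(\hat M_\alpha,\hat\varepsilon_{N,\alpha})$ for all $i$, and every $\eta>0$, $$T_\infty(\eta)\le AN^2(1+\log_+ 1/\eta).$$ 2. For sequences $(K_i)_{i\ge1}$ with $K_i\in\mathcal Q_N(\check M_\alpha,\check\varepsilon_{N,\alpha})$ for all $i$, the following holds. * If $\alpha>1$, then for every $\eta_0\in(0,1)$ there is a constant $A\in(0,\infty)$, depending only on $\alpha$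 and $\eta_0$, such that for all $N\ge1$, all such sequences and all $\eta\in(0,\eta_0]$, $$T_\infty(\eta)\le A\bigl(N^2+N^{1+\alpha}\log_+1/\eta\bigr).$$ * If $\alpha=1$, then for every $\eta_0\in(0,1)$ there is a constant $A\in(0,\infty)$, depending only on $\eta_0$, such that for all $N\ge2$, all such sequences and all $\eta\in(0,\eta_0]$, $$T_\infty(\eta)\le A\bigl(N^2+(N^2\log N)\log_+1/\eta\bigr).$$ * If $\alpha<1$, then there is a constant $A\in(0,\infty)$, depending only on $\alpha$, such that for all $N\ge1$, all such sequences and all $\eta>0$, $$T_\infty(\eta)\le AN^2(1+\log_+1/\eta).$$ -/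

import Mathlib

open scoped ENNReal

noncomputable section

namespace BDMerging

/-- The vertex set `V_N = {-N, …, 0, …, N}`. -/
abbrev Vtx (N : ℕ) : Type := {x : ℤ // x ∈ Finset.Icc (-(N : ℤ)) (N : ℤ)}

section Merging

variable {V : Type*} [Fintype V] [DecidableEq V]

/-- The iterated kernel `K_{0,n} = K_1 K_2 ⋯ K_n` of the time inhomogeneous chain driven by
`K_1, K_2, …` (the value `K 0` is not used). -/
def iterKernel (K : ℕ → Matrix V V ℝ) : ℕ → Matrix V V ℝ
  | 0 => 1
  | n + 1 => iterKernel K n * K (n + 1)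

/-- `|a / b - 1|` with the conventions `0 / 0 = 1` and `a / 0 = ∞` for `a ≠ 0`. -/
def relDev (a b : ℝ) : ℝ≥0∞ :=
  if b = 0 then (if a = 0 then 0 else ⊤) else ENNReal.ofReal |a / b - 1|

/-- `max_{x,y,z} |K_{0,n}(x,z) / K_{0,n}(y,z) - 1|`. -/
def relSup (K : ℕ → Matrix V V ℝ) (n : ℕ) : ℝ≥0∞ :=
  ⨆ (x : V) (y : V) (z : V), relDev (iterKernel K n x z) (iterKernel K n y z)

/-- The relative-sup merging time
`T_∞(η) = inf {n : max_{x,y,z} |K_{0,n}(x,z) / K_{0,n}(y,z) - 1| < η}`;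
it is `∞` if there is no such `n`. -/
def mergingTime (K : ℕ → Matrix V V ℝ) (η : ℝ) : ℕ∞ :=
  ⨅ (n : ℕ) (_ : relSup K n < ENNReal.ofReal η), (n : ℕ∞)

/-- The Metropolis chain with symmetric base kernel `Q` and target `π`: a proposed move
`x → y`, `y ≠ x`, is accepted with probability `min (1, π y / π x)`, and the chain stays at `x`
otherwise. -/
def metropolis (Q : Matrix V V ℝ) (π : V → ℝ) : Matrix V V ℝ :=
  Matrix.of fun x y =>
    if y = x then 1 - ∑ z ∈ Finset.univ.erase x, Q x z * min 1 (π z / π x)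
    else Q x y * min 1 (π y / π x)

/-- The probability vector proportional to the weight `w`. -/
def normalized (w : V → ℝ) : V → ℝ := fun x => w x / ∑ y, w y

end Merging

/-- Symmetric simple random walk on `V_N` with holding `1/3`, except at the two end points, where
the holding is `2/3`. -/
def baseWalk (N : ℕ) : Matrix (Vtx N) (Vtx N) ℝ :=
  Matrix.of fun x y =>
    if y = x then (if |x.1| = (N : ℤ) then 2 / 3 else 1 / 3)
    else if |x.1 - y.1| = 1 then 1 / 3 else 0

/-- `π̂_α(x) ∝ (N - |x| + 1)^α`. -/
def piHat (α : ℝ) (N : ℕ) : Vtx N → ℝ :=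
  normalized fun x => ((N : ℝ) - |(x.1 : ℝ)| + 1) ^ α

/-- `π̌_α(x) ∝ (|x| + 1)^α`. -/
def piCheck (α : ℝ) (N : ℕ) : Vtx N → ℝ :=
  normalized fun x => (|(x.1 : ℝ)| + 1) ^ α

/-- The Metropolis chain `M̂_α` on `V_N`. -/
def MHat (α : ℝ) (N : ℕ) : Matrix (Vtx N) (Vtx N) ℝ := metropolis (baseWalk N) (piHat α N)

/-- The Metropolis chain `M̌_α` on `V_N`. -/
def MCheck (α : ℝ) (N : ℕ) : Matrix (Vtx N) (Vtx N) ℝ := metropolis (baseWalk N) (piCheck α N)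

/-- The perturbation at the middle vertex: `Δ_s(0, ±1) = ± s`, and `Δ_s = 0` elsewhere. -/
def midPerturb (N : ℕ) (s : ℝ) : Matrix (Vtx N) (Vtx N) ℝ :=
  Matrix.of fun x y =>
    if x.1 = 0 ∧ y.1 = 1 then s else if x.1 = 0 ∧ y.1 = -1 then -s else 0

/-- The perturbation set `{Q + Δ_s : s ∈ [-ε, ε]}`. -/
def perturbSet {N : ℕ} (Q : Matrix (Vtx N) (Vtx N) ℝ) (ε : ℝ) :
    Set (Matrix (Vtx N) (Vtx N) ℝ) :=
  {P | ∃ s ∈ Set.Icc (-ε) ε, P = Q + midPerturb N s}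

/-- `ε̂_{N,α} = (1/6) (N / (N + 1))^α`, which is half of `M̂_α(0, ±1)`. -/
def epsHat (α : ℝ) (N : ℕ) : ℝ := 1 / 6 * ((N : ℝ) / ((N : ℝ) + 1)) ^ α

/-- `ε̌_{N,α} = 1/6`, which is half of `M̌_α(0, ±1)`. -/
def epsCheck : ℝ := 1 / 6

end BDMerging

end

/-!
A perturbation moves mass only within row `0`, from `1` to `-1` or back, so it keeps the row sums
over the orbits `{z, -z}` of the reflection. Hence `K_{0,n}(x, z) + K_{0,n}(x, -z)` is the same as
for the unperturbed chain `M`, and every upper bound `M ^ n ≤ C π` gives `K_{0,n}(x, z) ≤ 2 C π z`;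
such a bound holds for `n` of order `N ^ 2`, by way of a Faber–Krahn and a Nash inequality. A
perturbed step from `0` also retains at least half of each entry, so that
`K_{0,n}(0, ·) ≥ M ^ n (0, ·) / 2`. From any other vertex the middle one is reached in mean time at
most `G`, the maximal mean hitting time, which is explicit for a birth and death chain. Together
the two bounds make all rows of products of about `G + N ^ 2` kernels comparable, and an iteration
à la Doeblin gives merging in time of order `(G + N ^ 2) (1 + log₊ (1 / η))`. Finally
`G = O(N ^ 2)` for `M̂_α`, and `G = O(N ^ (1 + α) ∑_{j ≤ N} j ^ (-α))` for `M̌_α`.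
-/

namespace BDMerging

open Finset Matrix

section Reversible

variable {V : Type*} [Fintype V] [DecidableEq V] {M : Matrix V V ℝ} {π : V → ℝ}

/-- A Markov kernel `M` reversible with respect to the positive probability vector `π`. -/
structure IsReversible (M : Matrix V V ℝ) (π : V → ℝ) : Prop where
  stochastic : M ∈ rowStochastic ℝ V
  pos : ∀ x, 0 < π x
  sum_eq_one : ∑ x, π x = 1
  detailed_balance : ∀ x y, π x * M x y = π y * M y x

/-- The squared norm of `f` in `ℓ²(π)`. -/
noncomputable def normSq (π f : V → ℝ) : ℝ := ∑ x, π x * f x ^ 2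

/-- The Dirichlet form `⟨(1 - M) f, f⟩_π` of a reversible kernel, written as a sum over edges. -/
noncomputable def dirichletForm (M : Matrix V V ℝ) (π f : V → ℝ) : ℝ :=
  (∑ x, ∑ y, π x * M x y * (f x - f y) ^ 2) / 2

/-- The density `M(z, ·) / π` of the law of one step from `z`. -/
noncomputable def density (M : Matrix V V ℝ) (π : V → ℝ) (z x : V) : ℝ := M z x / π x

namespace IsReversible

lemma pow (hM : IsReversible M π) (n : ℕ) : IsReversible (M ^ n) π where
  stochastic := pow_mem hM.stochastic n
  pos := hM.pos
  sum_eq_one := hM.sum_eq_one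
  detailed_balance := by
    induction n with
    | zero => intro x y; rcases eq_or_ne x y with rfl | hxy <;> simp [*, Ne.symm]
    | succ n ih =>
      intro x y
      rw [pow_succ, mul_apply, ← pow_succ, pow_succ', mul_apply, mul_sum, mul_sum]
      refine sum_congr rfl fun z _ => ?_
      linear_combination M z y * ih x z + (M ^ n) z x * hM.detailed_balance z y

lemma entry_nonneg (hM : IsReversible M π) (x y : V) : 0 ≤ M x y :=
  nonneg_of_mem_rowStochastic hM.stochastic

lemma edge_nonneg (hM : IsReversible M π) (f : V → ℝ) (x y : V) :
    0 ≤ π x * M x y * (f x - f y) ^ 2 :=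
  mul_nonneg (mul_nonneg (hM.pos x).le (hM.entry_nonneg x y)) (sq_nonneg _)

lemma dirichletForm_nonneg (hM : IsReversible M π) (f : V → ℝ) : 0 ≤ dirichletForm M π f :=
  div_nonneg (sum_nonneg fun x _ => sum_nonneg fun y _ => hM.edge_nonneg f x y) two_pos.le

lemma sum_mul_mulVec_comm (hM : IsReversible M π) (f g : V → ℝ) :
    ∑ x, π x * (f x * (M *ᵥ g) x) = ∑ x, π x * ((M *ᵥ f) x * g x) := by
  simp only [mulVec, dotProduct, mul_sum, sum_mul]
  rw [sum_comm]
  refine sum_congr rfl fun x _ => sum_congr rfl fun y _ => ?_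
  linear_combination f y * g x * hM.detailed_balance y x

lemma sum_mul_row (hM : IsReversible M π) (f : V → ℝ) :
    ∑ x, ∑ y, π x * M x y * f x = ∑ x, π x * f x :=
  sum_congr rfl fun x _ => by
    rw [← sum_mul, ← mul_sum, sum_row_of_mem_rowStochastic hM.stochastic, mul_one]

lemma dirichletForm_eq (hM : IsReversible M π) (f : V → ℝ) :
    dirichletForm M π f = normSq π f - ∑ x, π x * (f x * (M *ᵥ f) x) := by
  have stationary : ∑ x, ∑ y, π x * M x y * f y ^ 2 = normSq π f := by
    rw [sum_comm]
    simp only [hM.detailed_balance _ _]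
    exact hM.sum_mul_row fun x => f x ^ 2
  have cross : ∑ x, ∑ y, π x * M x y * (f x * f y) = ∑ x, π x * (f x * (M *ᵥ f) x) := by
    simp only [mulVec, dotProduct, mul_sum]
    exact sum_congr rfl fun x _ => sum_congr rfl fun y _ => by ring
  have expand (x y) : π x * M x y * (f x - f y) ^ 2
      = π x * M x y * f x ^ 2 + π x * M x y * f y ^ 2 - 2 * (π x * M x y * (f x * f y)) := by ring
  simp only [dirichletForm, expand, sum_sub_distrib, sum_add_distrib, ← mul_sum]
  rw [hM.sum_mul_row fun x => f x ^ 2, stationary, cross, normSq]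
  ring

lemma normSq_sub_normSq_mulVec (hM : IsReversible M π) (f : V → ℝ) :
    normSq π f - normSq π (M *ᵥ f) = dirichletForm (M ^ 2) π f := by
  rw [(hM.pow 2).dirichletForm_eq, pow_two, ← mulVec_mulVec, hM.sum_mul_mulVec_comm]
  simp only [normSq, pow_two]

lemma two_mul_holding_mul_le_sq_apply (hM : IsReversible M π) {θ : ℝ} (hθ : ∀ x, θ ≤ M x x)
    {x y : V} (hxy : x ≠ y) : 2 * θ * M x y ≤ (M ^ 2) x y := by
  have two_terms : M x x * M x y + M x y * M y y ≤ (M ^ 2) x y := by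
    rw [pow_two, mul_apply, ← sum_pair (f := fun z => M x z * M z y) hxy]
    exact sum_le_sum_of_subset_of_nonneg (subset_univ _)
      fun z _ _ => mul_nonneg (hM.entry_nonneg x z) (hM.entry_nonneg z y)
  nlinarith [hM.entry_nonneg x y, hθ x, hθ y]

lemma two_mul_holding_mul_dirichletForm_le (hM : IsReversible M π) {θ : ℝ}
    (hθ : ∀ x, θ ≤ M x x) (f : V → ℝ) :
    2 * θ * dirichletForm M π f ≤ normSq π f - normSq π (M *ᵥ f) := by
  rw [hM.normSq_sub_normSq_mulVec, dirichletForm, dirichletForm, mul_div_assoc']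
  refine div_le_div_of_nonneg_right ?_ two_pos.le
  simp only [mul_sum]
  refine sum_le_sum fun x _ => sum_le_sum fun y _ => ?_
  rcases eq_or_ne x y with rfl | hxy
  · simp
  · have := mul_le_mul_of_nonneg_left (hM.two_mul_holding_mul_le_sq_apply hθ hxy)
      (mul_nonneg (hM.pos x).le (sq_nonneg (f x - f y)))
    linarith

lemma dirichletForm_truncate_le (hM : IsReversible M π) (f : V → ℝ) (l : ℝ) :
    dirichletForm M π (fun x => max (f x - l) 0) ≤ dirichletForm M π f := by
  refine div_le_div_of_nonneg_right (sum_le_sum fun x _ => sum_le_sum fun y _ => ?_) two_pos.le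
  refine mul_le_mul_of_nonneg_left (sq_le_sq.2 ?_)
    (mul_nonneg (hM.pos x).le (hM.entry_nonneg x y))
  exact (abs_max_sub_max_le_abs _ _ _).trans_eq (by rw [sub_sub_sub_cancel_right])

lemma density_nonneg (hM : IsReversible M π) (z x : V) : 0 ≤ density M π z x :=
  div_nonneg (hM.entry_nonneg z x) (hM.pos x).le

lemma mul_density (hM : IsReversible M π) (z x : V) : π x * density M π z x = M z x :=
  mul_div_cancel₀ _ (hM.pos x).ne'

lemma sum_mul_density (hM : IsReversible M π) (z : V) : ∑ x, π x * density M π z x = 1 := by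
  simp only [hM.mul_density, sum_row_of_mem_rowStochastic hM.stochastic]

lemma mul_density_symm (hM : IsReversible M π) (z x : V) : π z * density M π z x = M x z := by
  have := (hM.pos x).ne'
  rw [density, mul_div_assoc', hM.detailed_balance, mul_div_cancel_left₀ _ this]

lemma mulVec_density_pow (hM : IsReversible M π) (n : ℕ) (z : V) :
    M *ᵥ density (M ^ n) π z = density (M ^ (n + 1)) π z := by
  ext x
  refine mul_left_cancel₀ (hM.pos z).ne' ?_
  rw [(hM.pow _).mul_density_symm, pow_succ', mul_apply]
  simp only [mulVec, dotProduct, mul_sum, mul_left_comm (π z), (hM.pow n).mul_density_symm]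

lemma pow_add_self_apply (hM : IsReversible M π) (n : ℕ) (x z : V) :
    (M ^ (n + n)) x z = π z * ∑ y, π y * (density (M ^ n) π x y * density (M ^ n) π z y) := by
  rw [pow_add, mul_apply, mul_sum]
  refine sum_congr rfl fun y _ => ?_
  rw [← (hM.pow n).mul_density x y, ← (hM.pow n).mul_density_symm z y]
  ring

lemma pow_add_self_diag (hM : IsReversible M π) (n : ℕ) (z : V) :
    (M ^ (n + n)) z z = π z * normSq π (density (M ^ n) π z) := by
  rw [hM.pow_add_self_apply]
  simp only [normSq, pow_two]

lemma one_le_normSq_density (hM : IsReversible M π) (z : V) :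
    1 ≤ normSq π (density M π z) := by
  have := Real.pow_arith_mean_le_arith_mean_pow_of_even univ π (density M π z)
    (fun x _ => (hM.pos x).le) hM.sum_eq_one even_two
  rwa [hM.sum_mul_density, one_pow] at this

lemma le_pow_add_self_diag (hM : IsReversible M π) (n : ℕ) (z : V) :
    π z ≤ (M ^ (n + n)) z z := by
  rw [hM.pow_add_self_diag]
  exact le_mul_of_one_le_right (hM.pos z).le ((hM.pow n).one_le_normSq_density z)

lemma holding_mul_le_pow_diag (hM : IsReversible M π) {θ : ℝ} (hθ : ∀ x, θ ≤ M x x) (n : ℕ)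
    (x : V) : θ * π x ≤ (M ^ n) x x := by
  rcases Nat.even_or_odd' n with ⟨m, rfl | rfl⟩
  · have holding_le_one := (hθ x).trans (le_one_of_mem_rowStochastic hM.stochastic)
    rw [two_mul]
    exact (mul_le_of_le_one_left (hM.pos x).le holding_le_one).trans (hM.le_pow_add_self_diag m x)
  · calc θ * π x ≤ M x x * π x := mul_le_mul_of_nonneg_right (hθ x) (hM.pos x).le
      _ ≤ M x x * (M ^ (m + m)) x x :=
        mul_le_mul_of_nonneg_left (hM.le_pow_add_self_diag m x) (hM.entry_nonneg x x)
      _ ≤ ∑ y, M x y * (M ^ (m + m)) y x :=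
        single_le_sum (f := fun y => M x y * (M ^ (m + m)) y x)
          (fun y _ => mul_nonneg (hM.entry_nonneg x y) ((hM.pow _).entry_nonneg y x)) (mem_univ x)
      _ = (M ^ (2 * m + 1)) x x := by rw [two_mul, pow_succ', mul_apply]

lemma pow_add_self_le_of_normSq_density_le (hM : IsReversible M π) {C : ℝ} {n : ℕ}
    (h : ∀ z, normSq π (density (M ^ n) π z) ≤ C) (x z : V) :
    (M ^ (n + n)) x z ≤ C * π z := by
  have am_gm : 2 * ∑ y, π y * (density (M ^ n) π x y * density (M ^ n) π z y)
      ≤ normSq π (density (M ^ n) π x) + normSq π (density (M ^ n) π z) := by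
    rw [normSq, normSq, ← sum_add_distrib, mul_sum]
    refine sum_le_sum fun y _ => ?_
    nlinarith [mul_le_mul_of_nonneg_left
      (two_mul_le_add_sq (density (M ^ n) π x y) (density (M ^ n) π z y)) (hM.pos y).le]
  rw [hM.pow_add_self_apply, mul_comm C]
  exact mul_le_mul_of_nonneg_left (by linarith [h x, h z]) (hM.pos z).le

end IsReversible

end Reversible

section Nash

variable {V : Type*} [Fintype V] {M : Matrix V V ℝ} {π : V → ℝ}

/-- The `π`-mass of the support of `g`. -/
noncomputable def supportMass (π g : V → ℝ) : ℝ := ∑ x with g x ≠ 0, π x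

/-- The Faber–Krahn inequality with exponent `p` at volumes up to `v`: the Dirichlet eigenvalue of
a set of mass `m ≤ v` is at least `1 / (Λ m ^ p)`. The set is encoded as the support of a test
function. -/
def FaberKrahn (M : Matrix V V ℝ) (π : V → ℝ) (p Λ v : ℝ) : Prop :=
  ∀ g : V → ℝ, supportMass π g ≤ v →
    normSq π g ≤ Λ * supportMass π g ^ p * dirichletForm M π g

lemma supportMass_nonneg (hπ : ∀ x, 0 ≤ π x) (g : V → ℝ) : 0 ≤ supportMass π g :=
  sum_nonneg fun x _ => hπ x

lemma mul_supportMass_truncate_le (hπ : ∀ x, 0 ≤ π x) {h : V → ℝ} (h0 : ∀ x, 0 ≤ h x) (l : ℝ) :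
    l * supportMass π (fun x => max (h x - l) 0) ≤ ∑ x, π x * h x := by
  rw [supportMass, mul_sum]
  refine (sum_le_sum fun x hx => ?_).trans (sum_le_sum_of_subset_of_nonneg (subset_univ _)
    fun x _ _ => mul_nonneg (hπ x) (h0 x))
  rw [mul_comm]
  refine mul_le_mul_of_nonneg_left ?_ (hπ x)
  by_contra! hlt
  exact (mem_filter.1 hx).2 (max_eq_right (by linarith))

lemma normSq_sub_le_normSq_truncate (hπ : ∀ x, 0 ≤ π x) {h : V → ℝ} (h0 : ∀ x, 0 ≤ h x) {l : ℝ}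
    (hl : 0 ≤ l) :
    normSq π h - 2 * l * ∑ x, π x * h x ≤ normSq π (fun x => max (h x - l) 0) := by
  rw [normSq, normSq, mul_sum, ← sum_sub_distrib]
  refine sum_le_sum fun x _ => ?_
  have pointwise : h x ^ 2 - 2 * l * h x ≤ max (h x - l) 0 ^ 2 := by
    rcases le_total (h x) l with hx | hx
    · nlinarith [sq_nonneg (max (h x - l) 0), h0 x]
    · rw [max_eq_left (sub_nonneg.2 hx)]
      nlinarith [sq_nonneg l]
  nlinarith [mul_le_mul_of_nonneg_left pointwise (hπ x)]

variable [DecidableEq V]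

lemma FaberKrahn.mono {p Λ Λ' v : ℝ} (hFK : FaberKrahn M π p Λ v) (hM : IsReversible M π)
    (hΛ : Λ ≤ Λ') : FaberKrahn M π p Λ' v := fun g hg => (hFK g hg).trans <| by
  have := hM.dirichletForm_nonneg g
  have := supportMass_nonneg (fun x => (hM.pos x).le) g
  gcongr

lemma FaberKrahn.nash {p Λ v : ℝ} (hFK : FaberKrahn M π p Λ v) (hM : IsReversible M π)
    (hp : 0 ≤ p) (hΛ : 0 ≤ Λ) (hv : 0 < v) {h : V → ℝ} (h0 : ∀ x, 0 ≤ h x)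
    (h1 : ∑ x, π x * h x = 1) (hφ : 4 / v ≤ normSq π h) :
    normSq π h ^ (1 + p) ≤ 2 * 4 ^ p * Λ * dirichletForm M π h := by
  have π_nonneg (x) := (hM.pos x).le
  set φ := normSq π h
  set g : V → ℝ := fun x => max (h x - φ / 4) 0
  have φ_pos : 0 < φ := (div_pos four_pos hv).trans_le hφ
  have mass_le : supportMass π g ≤ 4 / φ := by
    have := mul_supportMass_truncate_le π_nonneg h0 (φ / 4)
    rw [h1] at this
    rw [le_div_iff₀ φ_pos]
    linarith
  have norm_ge : φ / 2 ≤ normSq π g := by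
    have := normSq_sub_le_normSq_truncate π_nonneg h0 (l := φ / 4) (by positivity)
    rw [h1] at this
    linarith
  have faber : normSq π g ≤ Λ * supportMass π g ^ p * dirichletForm M π g :=
    hFK g (mass_le.trans ((div_le_comm₀ hv φ_pos).1 hφ))
  have main : φ / 2 ≤ Λ * (4 / φ) ^ p * dirichletForm M π h := by
    refine norm_ge.trans (faber.trans ?_)
    have := supportMass_nonneg π_nonneg g
    have := hM.dirichletForm_nonneg g
    have := hM.dirichletForm_truncate_le h (φ / 4)
    gcongr
  rw [Real.div_rpow four_pos.le φ_pos.le] at main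
  rw [Real.rpow_add φ_pos, Real.rpow_one]
  calc φ * φ ^ p = 2 * φ ^ p * (φ / 2) := by ring
    _ ≤ 2 * φ ^ p * (Λ * (4 ^ p / φ ^ p) * dirichletForm M π h) :=
      mul_le_mul_of_nonneg_left main (by positivity)
    _ = 2 * 4 ^ p * Λ * dirichletForm M π h := by field_simp

end Nash

section Decay

-- The discrete form of: along `φ' = -φ ^ (1 + p) / s`, the power `φ ^ (-p)` grows at rate `p / s`.
lemma rpow_neg_add_div_le {a b p s : ℝ} (ha : 0 < a) (hb : 0 < b) (hp : 0 ≤ p) (hs : 0 < s)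
    (h : a ^ (1 + p) ≤ s * (a - b)) : a ^ (-p) + p / s ≤ b ^ (-p) := by
  rw [Real.rpow_add ha, Real.rpow_one] at h
  set u := a ^ p / s
  have le_mul_exp : b ≤ a * Real.exp (-u) := by
    have : a * u ≤ a - b := by
      rw [mul_div_assoc', div_le_iff₀ hs]
      linarith
    nlinarith [Real.add_one_le_exp (-u)]
  calc a ^ (-p) + p / s = a ^ (-p) * (p * u + 1) := by
        simp only [u, Real.rpow_neg ha.le]
        field_simp
        ring
    _ ≤ a ^ (-p) * Real.exp (p * u) :=
        mul_le_mul_of_nonneg_left (Real.add_one_le_exp _) (Real.rpow_nonneg ha.le _)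
    _ = (a * Real.exp (-u)) ^ (-p) := by
        rw [Real.mul_rpow ha.le (Real.exp_pos _).le, ← Real.exp_mul, neg_mul_neg, mul_comm p]
    _ ≤ b ^ (-p) := Real.rpow_le_rpow_of_nonpos hb le_mul_exp (neg_nonpos.2 hp)

lemma le_max_of_rpow_decay {φ : ℕ → ℝ} {p s Φ : ℝ} (hp : 0 < p) (hs : 0 < s)
    (hpos : ∀ n, 0 < φ n) (hanti : Antitone φ)
    (hstep : ∀ n, Φ ≤ φ n → φ n ^ (1 + p) ≤ s * (φ n - φ (n + 1))) {n : ℕ}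
    (hn : s ≤ p * n) : φ n ≤ max Φ 1 := by
  by_contra! hlt
  obtain ⟨hΦ, hone⟩ := max_lt_iff.1 hlt
  have growth : ∀ i ≤ n, p / s * i ≤ φ i ^ (-p) := by
    intro i hi
    induction i with
    | zero => simpa using Real.rpow_nonneg (hpos 0).le _
    | succ i ih =>
      have hi' := Nat.le_of_succ_le hi
      have := rpow_neg_add_div_le (hpos i) (hpos (i + 1)) hp.le hs
        (hstep i (hΦ.le.trans (hanti hi')))
      push_cast
      linarith [ih hi']
  have lt_one : φ n ^ (-p) < 1 := Real.rpow_lt_one_of_one_lt_of_neg hone (neg_lt_zero.2 hp)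
  have one_le : 1 ≤ p / s * n := by rwa [div_mul_eq_mul_div, le_div_iff₀ hs, one_mul]
  linarith [growth n le_rfl]

end Decay

section HeatKernel

variable {V : Type*} [Fintype V] [DecidableEq V] {M : Matrix V V ℝ} {π : V → ℝ}

lemma FaberKrahn.pow_add_self_le {p Λ v θ : ℝ} (hFK : FaberKrahn M π p Λ v)
    (hM : IsReversible M π) (hp : 0 < p) (hΛ : 0 < Λ) (hv : 0 < v) (hθ0 : 0 < θ)
    (hθ : ∀ x, θ ≤ M x x) {n : ℕ} (hn : 4 ^ p * Λ ≤ p * θ * n) (x z : V) :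
    (M ^ (n + n)) x z ≤ max (4 / v) 1 * π z := by
  refine hM.pow_add_self_le_of_normSq_density_le (fun z => ?_) x z
  set φ : ℕ → ℝ := fun n => normSq π (density (M ^ n) π z)
  have drop (n) : 2 * θ * dirichletForm M π (density (M ^ n) π z) ≤ φ n - φ (n + 1) := by
    simpa only [φ, ← hM.mulVec_density_pow] using hM.two_mul_holding_mul_dirichletForm_le hθ _
  have φ_anti : Antitone φ := antitone_nat_of_succ_le fun n =>
    sub_nonneg.1 ((mul_nonneg (by positivity) (hM.dirichletForm_nonneg _)).trans (drop n))
  refine le_max_of_rpow_decay hp (s := 4 ^ p * Λ / θ) (by positivity)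
    (fun n => one_pos.trans_le ((hM.pow n).one_le_normSq_density z)) φ_anti (fun m hm => ?_) ?_
  · calc φ m ^ (1 + p) ≤ 2 * 4 ^ p * Λ * dirichletForm M π (density (M ^ m) π z) :=
          hFK.nash hM hp.le hΛ.le hv ((hM.pow m).density_nonneg z) ((hM.pow m).sum_mul_density z) hm
      _ = 4 ^ p * Λ / θ * (2 * θ * dirichletForm M π (density (M ^ m) π z)) := by
          field_simp
      _ ≤ 4 ^ p * Λ / θ * (φ m - φ (m + 1)) :=
          mul_le_mul_of_nonneg_left (drop m) (by positivity)
  · rw [div_le_iff₀ hθ0]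
    linarith

end HeatKernel

section Paths

variable {V : Type*} [Fintype V] {M : Matrix V V ℝ} {π : V → ℝ} {k m : ℕ} {B : ℝ} {γ : V → ℕ → V}

/-- A choice, for every vertex `x`, of an injective path `γ x` of `k` steps starting at `x`, along
edges of conductance at least `π x / B`, in such a way that at no time more than `m` of the paths
visit the same vertex. -/
structure IsPathFamily [DecidableEq V] (M : Matrix V V ℝ) (π : V → ℝ) (k m : ℕ) (B : ℝ)
    (γ : V → ℕ → V) : Prop where
  start : ∀ x, γ x 0 = x
  injOn : ∀ x, Set.InjOn (γ x) (Set.Iic k)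
  conductance : ∀ x, ∀ j < k, π x ≤ B * (π (γ x j) * M (γ x j) (γ x (j + 1)))
  congestion : ∀ j < k, ∀ u, #{x | γ x j = u} ≤ m

variable [DecidableEq V]

lemma IsPathFamily.exists_eq_zero (hγ : IsPathFamily M π k m B γ) {g : V → ℝ}
    (hg : #{x | g x ≠ 0} ≤ k) (x : V) : ∃ j ≤ k, g (γ x j) = 0 := by
  by_contra! hne
  have subset : (range (k + 1)).image (γ x) ⊆ ({x | g x ≠ 0} : Finset V) := by
    simpa [image_subset_iff, Nat.lt_succ_iff] using hne
  have card_le := card_le_card subset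
  rw [card_image_of_injOn ((hγ.injOn x).mono fun j hj => by simpa [Nat.lt_succ_iff] using hj),
    card_range] at card_le
  omega

lemma IsPathFamily.sq_le_mul_sum_sq (hγ : IsPathFamily M π k m B γ) {g : V → ℝ}
    (hg : #{x | g x ≠ 0} ≤ k) (x : V) :
    g x ^ 2 ≤ k * ∑ i ∈ range k, (g (γ x i) - g (γ x (i + 1))) ^ 2 := by
  obtain ⟨j, hj, hgj⟩ := hγ.exists_eq_zero hg x
  calc g x ^ 2 = (∑ i ∈ range j, (g (γ x i) - g (γ x (i + 1)))) ^ 2 := by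
        rw [sum_range_sub' (fun i => g (γ x i)), hγ.start, hgj, sub_zero]
    _ ≤ j * ∑ i ∈ range j, (g (γ x i) - g (γ x (i + 1))) ^ 2 := by
        simpa only [card_range] using sq_sum_le_card_mul_sum_sq
          (s := range j) (f := fun i => g (γ x i) - g (γ x (i + 1)))
    _ ≤ k * ∑ i ∈ range k, (g (γ x i) - g (γ x (i + 1))) ^ 2 := by
        gcongr

lemma IsPathFamily.normSq_le (hγ : IsPathFamily M π k m B γ) (hM : IsReversible M π) (hB : 0 ≤ B)
    {g : V → ℝ} (hg : #{x | g x ≠ 0} ≤ k) :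
    normSq π g ≤ 2 * m * B * (k : ℝ) ^ 2 * dirichletForm M π g := by
  set e : V → ℝ := fun u => ∑ v, π u * M u v * (g u - g v) ^ 2
  have along_path (x) : π x * g x ^ 2 ≤ k * B * ∑ j ∈ range k, e (γ x j) := by
    refine (mul_le_mul_of_nonneg_left (hγ.sq_le_mul_sum_sq hg x) (hM.pos x).le).trans ?_
    rw [mul_left_comm, mul_assoc, mul_sum _ _ (π x), mul_sum _ _ B]
    refine mul_le_mul_of_nonneg_left (sum_le_sum fun j hj => ?_) (Nat.cast_nonneg k)
    calc π x * (g (γ x j) - g (γ x (j + 1))) ^ 2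
        ≤ B * (π (γ x j) * M (γ x j) (γ x (j + 1))) * (g (γ x j) - g (γ x (j + 1))) ^ 2 :=
          mul_le_mul_of_nonneg_right (hγ.conductance x j (mem_range.1 hj)) (sq_nonneg _)
      _ ≤ B * e (γ x j) := by
          rw [mul_assoc]
          exact mul_le_mul_of_nonneg_left (single_le_sum
            (f := fun v => π (γ x j) * M (γ x j) v * (g (γ x j) - g v) ^ 2)
            (fun v _ => hM.edge_nonneg g _ v) (mem_univ _)) hB
  have at_time (j) (hj : j ∈ range k) : ∑ x, e (γ x j) ≤ m * (2 * dirichletForm M π g) := by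
    rw [dirichletForm, mul_div_cancel₀ _ two_ne_zero, ← sum_fiberwise' univ (fun x => γ x j) e,
      mul_sum]
    refine sum_le_sum fun u _ => ?_
    rw [sum_const, nsmul_eq_mul]
    exact mul_le_mul_of_nonneg_right (mod_cast hγ.congestion j (mem_range.1 hj) u)
      (sum_nonneg fun v _ => hM.edge_nonneg g u v)
  calc normSq π g ≤ ∑ x, k * B * ∑ j ∈ range k, e (γ x j) := sum_le_sum fun x _ => along_path x
    _ = k * B * ∑ j ∈ range k, ∑ x, e (γ x j) := by rw [← mul_sum, sum_comm]
    _ ≤ k * B * ∑ _j ∈ range k, m * (2 * dirichletForm M π g) :=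
        mul_le_mul_of_nonneg_left (sum_le_sum at_time) (by positivity)
    _ = 2 * m * B * (k : ℝ) ^ 2 * dirichletForm M π g := by
        rw [sum_const, card_range, nsmul_eq_mul]
        ring

lemma faberKrahn_of_pathFamily (hM : IsReversible M π) (hB : 0 ≤ B) {c D r : ℝ} (hc : 0 < c)
    (hD : 0 < D) (hr : 0 ≤ r) (hpath : ∀ k : ℕ, k ≤ r → ∃ γ, IsPathFamily M π k m B γ)
    (hvol : ∀ S : Finset V, c * (#S : ℝ) ^ D ≤ ∑ x ∈ S, π x) :
    FaberKrahn M π (2 / D) (2 * m * B * (c ^ (2 / D))⁻¹) (c * r ^ D) := by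
  intro g hg
  set k := #{x | g x ≠ 0}
  have volume : c * (k : ℝ) ^ D ≤ supportMass π g := hvol _
  have card_le : (k : ℝ) ≤ r :=
    (Real.rpow_le_rpow_iff (Nat.cast_nonneg k) hr hD).1
      (le_of_mul_le_mul_left (volume.trans hg) hc)
  have card_sq_le : (k : ℝ) ^ 2 ≤ (c ^ (2 / D))⁻¹ * supportMass π g ^ (2 / D) := by
    rw [inv_mul_eq_div, ← Real.div_rpow (supportMass_nonneg (fun x => (hM.pos x).le) g) hc.le]
    calc (k : ℝ) ^ 2 = ((k : ℝ) ^ D) ^ (2 / D) := by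
          rw [← Real.rpow_mul (Nat.cast_nonneg k), mul_div_cancel₀ _ hD.ne', Real.rpow_two]
      _ ≤ (supportMass π g / c) ^ (2 / D) := by
          gcongr
          rwa [le_div_iff₀' hc]
  obtain ⟨γ, hγ⟩ := hpath k card_le
  calc normSq π g ≤ 2 * m * B * (k : ℝ) ^ 2 * dirichletForm M π g := hγ.normSq_le hM hB le_rfl
    _ ≤ 2 * m * B * ((c ^ (2 / D))⁻¹ * supportMass π g ^ (2 / D)) * dirichletForm M π g := by
        gcongr
        exact hM.dirichletForm_nonneg g
    _ = _ := by ring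

end Paths

section Merging

variable {V : Type*} [Fintype V] [DecidableEq V] {𝒬 : Set (Matrix V V ℝ)} {K : ℕ → Matrix V V ℝ}

/-- The chain with step kernels `K 1, K 2, …` is driven by the set `𝒬` if these kernels all belong
to `𝒬`. As in `iterKernel`, the value `K 0` plays no role. -/
def DrivenBy (𝒬 : Set (Matrix V V ℝ)) (K : ℕ → Matrix V V ℝ) : Prop := ∀ i, 1 ≤ i → K i ∈ 𝒬

/-- The products of `T` kernels from `𝒬` have positive entries, and the entries within a column
differ at most by a factor `R`. -/
def ComparableRows (𝒬 : Set (Matrix V V ℝ)) (T : ℕ) (R : ℝ) : Prop :=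
  ∀ K, DrivenBy 𝒬 K → ∀ x y z,
    0 < iterKernel K T x z ∧ iterKernel K T x z ≤ R * iterKernel K T y z

omit [Fintype V] [DecidableEq V] in
lemma DrivenBy.shift (hK : DrivenBy 𝒬 K) (m : ℕ) : DrivenBy 𝒬 fun i => K (m + i) :=
  fun _ hi => hK _ (le_add_left hi)

lemma iterKernel_add (K : ℕ → Matrix V V ℝ) (m n : ℕ) :
    iterKernel K (m + n) = iterKernel K m * iterKernel (fun i => K (m + i)) n := by
  induction n with
  | zero => simp [iterKernel]
  | succ n ih => rw [← add_assoc, iterKernel, ih, iterKernel, mul_assoc, add_assoc]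

lemma iterKernel_succ' (K : ℕ → Matrix V V ℝ) (n : ℕ) :
    iterKernel K (n + 1) = K 1 * iterKernel (fun i => K (1 + i)) n := by
  rw [add_comm, iterKernel_add, iterKernel, iterKernel, one_mul]

lemma DrivenBy.iterKernel_eq_pow {M : Matrix V V ℝ} (hK : DrivenBy {M} K) (n : ℕ) :
    iterKernel K n = M ^ n := by
  induction n with
  | zero => rfl
  | succ n ih => rw [iterKernel, ih, hK (n + 1) n.succ_pos, pow_succ]

lemma DrivenBy.iterKernel_mem (hK : DrivenBy 𝒬 K) (h𝒬 : 𝒬 ⊆ rowStochastic ℝ V) (n : ℕ) :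
    iterKernel K n ∈ rowStochastic ℝ V := by
  induction n with
  | zero => exact one_mem _
  | succ n ih => exact mul_mem ih (h𝒬 (hK (n + 1) n.succ_pos))

/- Doeblin's argument: all rows of `P` dominate `R⁻¹` times a given one, so averaging over the rows
removes the proportion `R⁻¹` of the oscillation of `f`. -/
lemma mulVec_le_of_comparable_rows {P : Matrix V V ℝ} (hP : P ∈ rowStochastic ℝ V) {R δ : ℝ}
    (hR : 1 ≤ R) (hPR : ∀ x y z, P x z ≤ R * P y z) (hδ : 0 ≤ δ) {f : V → ℝ}
    (hf : ∀ x y, f x ≤ (1 + δ) * f y) (x y : V) :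
    (P *ᵥ f) x ≤ (1 + (1 - R⁻¹) * δ) * (P *ᵥ f) y := by
  have R_pos : 0 < R := one_pos.trans_le hR
  have contraction_nonneg : 0 ≤ 1 - R⁻¹ := sub_nonneg.2 (inv_le_one_of_one_le₀ hR)
  obtain ⟨v, -, hv⟩ := exists_min_image univ f ⟨x, mem_univ x⟩
  have f_min (u) : f v ≤ f u := hv u (mem_univ u)
  have difference : (P *ᵥ f) x - (P *ᵥ f) y = ∑ u, (P x u - P y u) * (f u - f v) := by
    simp only [mulVec, dotProduct, sub_mul, mul_sub, sum_sub_distrib, ← sum_mul,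
      sum_row_of_mem_rowStochastic hP]
    ring
  have oscillation : ∑ u, (P x u - P y u) * (f u - f v) ≤ (1 - R⁻¹) * δ * f v := by
    have termwise (u) : (P x u - P y u) * (f u - f v) ≤ P x u * ((1 - R⁻¹) * δ * f v) := by
      have row_le : P x u - P y u ≤ (1 - R⁻¹) * P x u := by
        have : R⁻¹ * P x u ≤ P y u := (inv_mul_le_iff₀ R_pos).2 (hPR x y u)
        linarith
      calc (P x u - P y u) * (f u - f v) ≤ (1 - R⁻¹) * P x u * (f u - f v) :=
            mul_le_mul_of_nonneg_right row_le (sub_nonneg.2 (f_min u))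
        _ ≤ (1 - R⁻¹) * P x u * (δ * f v) :=
            mul_le_mul_of_nonneg_left (by linarith [hf u v])
              (mul_nonneg contraction_nonneg (nonneg_of_mem_rowStochastic hP))
        _ = P x u * ((1 - R⁻¹) * δ * f v) := by ring
    refine (sum_le_sum fun u _ => termwise u).trans_eq ?_
    rw [← sum_mul, sum_row_of_mem_rowStochastic hP, one_mul]
  have average_ge : f v ≤ (P *ᵥ f) y := by
    calc f v = ∑ u, P y u * f v := by rw [← sum_mul, sum_row_of_mem_rowStochastic hP, one_mul]
      _ ≤ (P *ᵥ f) y := sum_le_sum fun u _ =>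
        mul_le_mul_of_nonneg_left (f_min u) (nonneg_of_mem_rowStochastic hP)
  linarith [mul_le_mul_of_nonneg_left average_ge (mul_nonneg contraction_nonneg hδ)]

lemma ComparableRows.iterate {T : ℕ} {R : ℝ} (hT : ComparableRows 𝒬 T R)
    (h𝒬 : 𝒬 ⊆ rowStochastic ℝ V) (hR : 1 ≤ R) (q : ℕ) :
    ComparableRows 𝒬 ((q + 1) * T) (1 + (1 - R⁻¹) ^ q * (R - 1)) := by
  induction q with
  | zero => simpa using hT
  | succ q ih =>
    intro K hK x y z
    have tail := ih _ (hK.shift T)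
    have split_block (u : V) : iterKernel K ((q + 1 + 1) * T) u z
        = (iterKernel K T *ᵥ fun w => iterKernel (fun i => K (T + i)) ((q + 1) * T) w z) u := by
      rw [show (q + 1 + 1) * T = T + (q + 1) * T by ring, iterKernel_add]
      rfl
    rw [split_block, split_block, pow_succ', mul_assoc]
    refine ⟨sum_pos (fun u _ => mul_pos (hT K hK x x u).1 (tail u u z).1) ⟨x, mem_univ x⟩, ?_⟩
    refine mulVec_le_of_comparable_rows (hK.iterKernel_mem h𝒬 T) hR
      (fun x y z => (hT K hK x y z).2) (mul_nonneg (pow_nonneg ?_ q) (sub_nonneg.2 hR))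
      (fun u w => (tail u w z).2) x y
    exact sub_nonneg.2 (inv_le_one_of_one_le₀ hR)

lemma abs_div_sub_one_le {a b δ : ℝ} (hb : 0 < b) (hδ : 0 ≤ δ) (hab : a ≤ (1 + δ) * b)
    (hba : b ≤ (1 + δ) * a) : |a / b - 1| ≤ δ := by
  rw [div_sub_one hb.ne', abs_div, abs_of_pos hb, div_le_iff₀ hb, abs_le]
  constructor <;> nlinarith

lemma mergingTime_le_of_ratio {n : ℕ} {δ η : ℝ} (hδ : 0 ≤ δ) (hη : δ < η)
    (h : ∀ x y z, 0 < iterKernel K n x z ∧ iterKernel K n x z ≤ (1 + δ) * iterKernel K n y z) :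
    mergingTime K η ≤ n := by
  refine iInf₂_le_of_le n (lt_of_le_of_lt (iSup_le fun x => iSup_le fun y => iSup_le fun z => ?_)
    ((ENNReal.ofReal_lt_ofReal_iff (hδ.trans_lt hη)).2 hη)) le_rfl
  have pos := (h y x z).1
  rw [relDev, if_neg pos.ne']
  exact ENNReal.ofReal_le_ofReal (abs_div_sub_one_le pos hδ (h x y z).2 (h y x z).2)

lemma exists_contraction_pow_lt {R η : ℝ} (hR : 1 ≤ R) (hη : 0 < η) :
    ∃ q : ℕ, (1 - R⁻¹) ^ q * (R - 1) < η ∧ q ≤ R * (Real.log R + Real.posLog (1 / η)) + 1 := by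
  have R_pos : 0 < R := one_pos.trans_le hR
  have posLog_nonneg : 0 ≤ Real.posLog (1 / η) := Real.posLog_nonneg
  have log_nonneg : 0 ≤ Real.log R := Real.log_nonneg hR
  set q := ⌈R * (Real.log R + Real.posLog (1 / η))⌉₊
  refine ⟨q, ?_, (Nat.ceil_lt_add_one (by positivity)).le⟩
  have pow_le : (1 - R⁻¹) ^ q ≤ Real.exp (-(q / R)) := by
    have := pow_le_pow_left₀ (sub_nonneg.2 (inv_le_one_of_one_le₀ hR))
      (Real.one_sub_le_exp_neg R⁻¹) q
    rwa [← Real.exp_nat_mul, mul_neg, ← div_eq_mul_inv] at this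
  have exp_le : Real.exp (-(q / R)) * R ≤ η := by
    have log_le : Real.log R + Real.posLog (1 / η) ≤ q / R :=
      (le_div_iff₀' R_pos).2 (Nat.le_ceil _)
    have neg_log_le : -Real.log η ≤ Real.posLog (1 / η) := by
      rw [← Real.log_inv, ← one_div]
      exact le_max_right _ _
    nth_rw 2 [← Real.exp_log R_pos]
    rw [← Real.exp_add, ← Real.le_log_iff_exp_le hη]
    linarith
  calc (1 - R⁻¹) ^ q * (R - 1) ≤ Real.exp (-(q / R)) * (R - 1) :=
        mul_le_mul_of_nonneg_right pow_le (sub_nonneg.2 hR)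
    _ < Real.exp (-(q / R)) * R := mul_lt_mul_of_pos_left (sub_one_lt R) (Real.exp_pos _)
    _ ≤ η := exp_le

lemma ComparableRows.mergingTime_le {T : ℕ} {R : ℝ} (hT : ComparableRows 𝒬 T R)
    (h𝒬 : 𝒬 ⊆ rowStochastic ℝ V) (hR : 1 ≤ R) (hK : DrivenBy 𝒬 K) {η : ℝ} (hη : 0 < η) :
    (mergingTime K η : ℝ≥0∞) ≤
      ENNReal.ofReal ((2 + R + R * Real.log R) * (T * (1 + Real.posLog (1 / η)))) := by
  obtain ⟨q, hq, q_le⟩ := exists_contraction_pow_lt hR hη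
  have merged : mergingTime K η ≤ ((q + 1) * T : ℕ) :=
    mergingTime_le_of_ratio (mul_nonneg (pow_nonneg
      (sub_nonneg.2 (inv_le_one_of_one_le₀ hR)) q) (sub_nonneg.2 hR)) hq (hT.iterate h𝒬 hR q K hK)
  have posLog_nonneg : 0 ≤ Real.posLog (1 / η) := Real.posLog_nonneg
  have log_nonneg : 0 ≤ Real.log R := Real.log_nonneg hR
  have R_nonneg : 0 ≤ R := zero_le_one.trans hR
  have blocks_le : (q : ℝ) + 1 ≤ (2 + R + R * Real.log R) * (1 + Real.posLog (1 / η)) := by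
    nlinarith [mul_nonneg (mul_nonneg R_nonneg log_nonneg) posLog_nonneg]
  calc (mergingTime K η : ℝ≥0∞) ≤ (((q + 1) * T : ℕ) : ℕ∞) := mod_cast merged
    _ = ENNReal.ofReal (((q + 1) * T : ℕ) : ℝ) := by rw [ENNReal.ofReal_natCast]; rfl
    _ ≤ _ := by
      refine ENNReal.ofReal_le_ofReal ?_
      push_cast
      linarith [mul_le_mul_of_nonneg_right blocks_le (Nat.cast_nonneg (α := ℝ) T)]

end Merging

section Lyapunov

variable {V : Type*} [Fintype V] [DecidableEq V] {𝒬 : Set (Matrix V V ℝ)} {o : V} {W : V → ℝ}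

/-- Under every kernel of `𝒬` the function `W` decreases on average by at least one per step away
from `o`. -/
def HasUnitDrift (𝒬 : Set (Matrix V V ℝ)) (o : V) (W : V → ℝ) : Prop :=
  ∀ P ∈ 𝒬, ∀ x, x ≠ o → (P *ᵥ W) x ≤ W x - 1

lemma HasUnitDrift.mul_sub_le (hW : HasUnitDrift 𝒬 o W) (h𝒬 : 𝒬 ⊆ rowStochastic ℝ V)
    (hW0 : ∀ x, 0 ≤ W x) {n₀ : ℕ} {q : ℝ} (hq : 0 ≤ q) {z : V}
    (hmid : ∀ K, DrivenBy 𝒬 K → ∀ n, n₀ ≤ n → q ≤ iterKernel K n o z)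
    {K : ℕ → Matrix V V ℝ} (hK : DrivenBy 𝒬 K) (k : ℕ) (x : V) :
    q * (k - W x) ≤ k * iterKernel K (n₀ + k) x z := by
  induction k generalizing K x with
  | zero => simpa using mul_nonneg hq (hW0 x)
  | succ k ih =>
    rcases eq_or_ne x o with rfl | hx
    · have := hmid K hK (n₀ + (k + 1)) (Nat.le_add_right _ _)
      rw [mul_comm]
      exact mul_le_mul (by linarith [hW0 x]) this hq (Nat.cast_nonneg _)
    set tail := iterKernel (fun i => K (1 + i)) (n₀ + k)
    have K₁_mem := h𝒬 (hK 1 le_rfl)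
    have first_step : (K 1 *ᵥ fun u => q * (k - W u)) x ≤ (K 1 *ᵥ fun u => k * tail u z) x :=
      sum_le_sum fun u _ => mul_le_mul_of_nonneg_left (ih (hK.shift 1) u)
        (nonneg_of_mem_rowStochastic K₁_mem)
    have lhs : (K 1 *ᵥ fun u => q * (k - W u)) x = q * (k - (K 1 *ᵥ W) x) := by
      simp only [mulVec, dotProduct, mul_left_comm _ q, ← mul_sum, mul_sub, sum_sub_distrib,
        ← sum_mul, sum_row_of_mem_rowStochastic K₁_mem, one_mul]
    have rhs : (K 1 *ᵥ fun u => k * tail u z) x = k * iterKernel K (n₀ + (k + 1)) x z := by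
      rw [← add_assoc, iterKernel_succ', mul_apply, mul_sum]
      exact sum_congr rfl fun u _ => mul_left_comm _ _ _
    have drift := mul_le_mul_of_nonneg_left (hW _ (hK 1 le_rfl) x hx) hq
    have : 0 ≤ iterKernel K (n₀ + (k + 1)) x z :=
      nonneg_of_mem_rowStochastic (hK.iterKernel_mem h𝒬 _)
    push_cast
    linarith

lemma HasUnitDrift.half_le_iterKernel (hW : HasUnitDrift 𝒬 o W) (h𝒬 : 𝒬 ⊆ rowStochastic ℝ V)
    (hW0 : ∀ x, 0 ≤ W x) {H : ℝ} (hH : 0 < H) (hWH : ∀ x, W x ≤ H) {n₀ : ℕ} {q : ℝ} (hq : 0 ≤ q)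
    {z : V} (hmid : ∀ K, DrivenBy 𝒬 K → ∀ n, n₀ ≤ n → q ≤ iterKernel K n o z)
    {K : ℕ → Matrix V V ℝ} (hK : DrivenBy 𝒬 K) {n : ℕ} (hn : n₀ + 2 * H ≤ n) (x : V) :
    q / 2 ≤ iterKernel K n x z := by
  have n₀_le : n₀ ≤ n := by
    have : (n₀ : ℝ) ≤ n := by linarith
    exact_mod_cast this
  obtain ⟨k, rfl⟩ := Nat.exists_eq_add_of_le n₀_le
  push_cast at hn
  have k_pos : (0 : ℝ) < k := by linarith
  refine le_of_mul_le_mul_left ?_ k_pos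
  calc k * (q / 2) = q * (k - k / 2) := by ring
    _ ≤ q * (k - W x) := mul_le_mul_of_nonneg_left (by linarith [hWH x]) hq
    _ ≤ k * iterKernel K (n₀ + k) x z := hW.mul_sub_le h𝒬 hW0 hq hmid hK k x

end Lyapunov

section OrbitPerturbation

variable {V : Type*} [Fintype V] [DecidableEq V] {M : Matrix V V ℝ} {π W : V → ℝ} {o : V}
  {σ : Equiv.Perm V} {L : ℝ} {K : ℕ → Matrix V V ℝ}

/-- `P` is a Markov kernel that differs from `M` only in row `o`, where it keeps the sum over every
orbit of the involution `σ` and retains at least the proportion `1 / L` of every entry. -/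
structure IsOrbitPerturbation (M : Matrix V V ℝ) (o : V) (σ : Equiv.Perm V) (L : ℝ)
    (P : Matrix V V ℝ) : Prop where
  stochastic : P ∈ rowStochastic ℝ V
  row_eq : ∀ x, x ≠ o → P x = M x
  orbit_sum : ∀ z, P o z + P o (σ z) = M o z + M o (σ z)
  le_mul : ∀ z, M o z ≤ L * P o z

/-- The set of all perturbations of `M` in the sense of `IsOrbitPerturbation`. -/
def orbitPerturbations (M : Matrix V V ℝ) (o : V) (σ : Equiv.Perm V) (L : ℝ) :
    Set (Matrix V V ℝ) :=
  {P | IsOrbitPerturbation M o σ L P}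

lemma orbitPerturbations_subset : orbitPerturbations M o σ L ⊆ rowStochastic ℝ V :=
  fun _ hP => hP.stochastic

omit [DecidableEq V] in
lemma sum_mul_eq_of_orbit_sum_eq {a b g : V → ℝ} (hg : ∀ u, g (σ u) = g u)
    (hab : ∀ u, a u + a (σ u) = b u + b (σ u)) : ∑ u, a u * g u = ∑ u, b u * g u := by
  have symmetrize (c : V → ℝ) : 2 * ∑ u, c u * g u = ∑ u, (c u + c (σ u)) * g u := by
    have : ∑ u, c (σ u) * g u = ∑ u, c u * g u := by
      simpa only [hg] using Equiv.sum_comp σ fun u => c u * g u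
    simp only [add_mul, sum_add_distrib, this, two_mul]
  have := (symmetrize a).trans ((symmetrize b).trans (by simp only [hab])).symm
  linarith

lemma iterKernel_orbit_sum (hσ : Function.Involutive σ) (hMσ : ∀ x y, M (σ x) (σ y) = M x y)
    (hK : DrivenBy (orbitPerturbations M o σ L) K) (n : ℕ) (x z : V) :
    iterKernel K n x z + iterKernel K n x (σ z) = (M ^ n) x z + (M ^ n) x (σ z) := by
  induction n generalizing z with
  | zero => rfl
  | succ n ih =>
    have perturbed_sum (u : V) : K (n + 1) u z + K (n + 1) u (σ z) = M u z + M u (σ z) := by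
      have step := hK (n + 1) n.succ_pos
      rcases eq_or_ne u o with rfl | hu
      · exact step.orbit_sum z
      · rw [step.row_eq u hu]
    have invariant (u : V) : M (σ u) z + M (σ u) (σ z) = M u z + M u (σ z) := by
      rw [hMσ, add_comm, ← hMσ u (σ z), hσ z]
    simp only [iterKernel, pow_succ, mul_apply, ← sum_add_distrib, ← mul_add, perturbed_sum]
    exact sum_mul_eq_of_orbit_sum_eq invariant ih

lemma iterKernel_apply_fixed (hσ : Function.Involutive σ) (hMσ : ∀ x y, M (σ x) (σ y) = M x y)
    (hσo : σ o = o) (hK : DrivenBy (orbitPerturbations M o σ L) K) (n : ℕ) (x : V) :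
    iterKernel K n x o = (M ^ n) x o := by
  have := iterKernel_orbit_sum hσ hMσ hK n x o
  rw [hσo] at this
  linarith

lemma pow_le_mul_iterKernel (hM : M ∈ rowStochastic ℝ V) (hL : 1 ≤ L)
    (hσ : Function.Involutive σ) (hMσ : ∀ x y, M (σ x) (σ y) = M x y) (hσo : σ o = o)
    (hK : DrivenBy (orbitPerturbations M o σ L) K) (n : ℕ) (z : V) :
    (M ^ n) o z ≤ L * iterKernel K n o z := by
  induction n generalizing z with
  | zero => exact le_mul_of_one_le_left (nonneg_of_mem_rowStochastic (pow_mem hM 0)) hL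
  | succ n ih =>
    have step := hK (n + 1) n.succ_pos
    rw [pow_succ, iterKernel, mul_apply, mul_apply, mul_sum]
    refine sum_le_sum fun u _ => ?_
    rcases eq_or_ne u o with rfl | hu
    · rw [iterKernel_apply_fixed hσ hMσ hσo hK, mul_left_comm]
      exact mul_le_mul_of_nonneg_left (step.le_mul z) (nonneg_of_mem_rowStochastic (pow_mem hM n))
    · rw [step.row_eq u hu, ← mul_assoc]
      exact mul_le_mul_of_nonneg_right (ih u) (nonneg_of_mem_rowStochastic hM)

lemma IsReversible.mul_le_pow_apply_of_unitDrift (hM : IsReversible M π) {θ : ℝ} (hθ0 : 0 < θ)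
    (hθ : ∀ x, θ ≤ M x x) (hW : HasUnitDrift {M} o W) (hW0 : ∀ x, 0 ≤ W x) {H : ℝ} (hH : 0 < H)
    (hWH : ∀ x, W x ≤ H) {n : ℕ} (hn : 2 * H ≤ n) (z : V) : θ * π z / 2 ≤ (M ^ n) o z := by
  have const_driven : DrivenBy {M} fun _ => M := fun _ _ => rfl
  have to_o : θ * π o / 2 ≤ (M ^ n) z o := by
    rw [← const_driven.iterKernel_eq_pow]
    refine hW.half_le_iterKernel (Set.singleton_subset_iff.2 hM.stochastic) hW0 hH hWH (n₀ := 0)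
      (mul_pos hθ0 (hM.pos o)).le (fun K hK n _ => ?_) const_driven (by simpa using hn) z
    rw [hK.iterKernel_eq_pow]
    exact hM.holding_mul_le_pow_diag hθ n o
  refine le_of_mul_le_mul_left ?_ (hM.pos o)
  rw [(hM.pow n).detailed_balance]
  linarith [mul_le_mul_of_nonneg_left to_o (hM.pos z).le]

lemma mul_le_iterKernel_of_unitDrift (hM : IsReversible M π) {θ : ℝ} (hθ0 : 0 < θ)
    (hθ : ∀ x, θ ≤ M x x) (hL : 1 ≤ L) (hσ : Function.Involutive σ)
    (hMσ : ∀ x y, M (σ x) (σ y) = M x y) (hσo : σ o = o) (hW : HasUnitDrift {M} o W)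
    (hW0 : ∀ x, 0 ≤ W x) {H : ℝ} (hH : 0 < H) (hWH : ∀ x, W x ≤ H)
    (hK : DrivenBy (orbitPerturbations M o σ L) K) {n : ℕ} (hn : 4 * H + 1 ≤ n) (x z : V) :
    θ * π z / (4 * L) ≤ iterKernel K n x z := by
  have L_pos : 0 < L := one_pos.trans_le hL
  have from_o (K : ℕ → Matrix V V ℝ) (hK : DrivenBy (orbitPerturbations M o σ L) K) (n : ℕ)
      (hn : ⌈2 * H⌉₊ ≤ n) : θ * π z / (2 * L) ≤ iterKernel K n o z := by
    have unperturbed :=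
      hM.mul_le_pow_apply_of_unitDrift hθ0 hθ hW hW0 hH hWH (Nat.le_of_ceil_le hn) z
    rw [← div_div, div_le_iff₀' L_pos]
    exact unperturbed.trans (pow_le_mul_iterKernel hM.stochastic hL hσ hMσ hσo hK n z)
  have drift : HasUnitDrift (orbitPerturbations M o σ L) o W := fun P hP x hx => by
    simpa only [mulVec, hP.row_eq x hx] using hW M rfl x hx
  have ceil_lt := Nat.ceil_lt_add_one (show 0 ≤ 2 * H by positivity)
  calc θ * π z / (4 * L) = θ * π z / (2 * L) / 2 := by ring
    _ ≤ iterKernel K n x z := drift.half_le_iterKernel orbitPerturbations_subset hW0 hH hWH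
      (div_nonneg (mul_pos hθ0 (hM.pos z)).le (by positivity)) from_o hK (by linarith) x

lemma comparableRows_orbitPerturbations (hM : IsReversible M π) {θ : ℝ} (hθ0 : 0 < θ)
    (hθ : ∀ x, θ ≤ M x x) (hL : 1 ≤ L) (hσ : Function.Involutive σ)
    (hMσ : ∀ x y, M (σ x) (σ y) = M x y) (hπσ : ∀ x, π (σ x) = π x) (hσo : σ o = o)
    (hW : HasUnitDrift {M} o W) (hW0 : ∀ x, 0 ≤ W x) {H : ℝ} (hH : 0 < H) (hWH : ∀ x, W x ≤ H)
    {T : ℕ} (hT : 4 * H + 1 ≤ T) {C : ℝ} (hC : 0 ≤ C) (hupper : ∀ x z, (M ^ T) x z ≤ C * π z) :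
    ComparableRows (orbitPerturbations M o σ L) T (8 * L * C / θ) := by
  intro K hK x y z
  have lower (x) := mul_le_iterKernel_of_unitDrift hM hθ0 hθ hL hσ hMσ hσo hW hW0 hH hWH hK hT x z
  have : 0 < L := one_pos.trans_le hL
  refine ⟨(div_pos (mul_pos hθ0 (hM.pos z)) (by positivity)).trans_le (lower x), ?_⟩
  have other_nonneg : 0 ≤ iterKernel K T x (σ z) :=
    nonneg_of_mem_rowStochastic (hK.iterKernel_mem orbitPerturbations_subset T)
  have orbit_le := hupper x (σ z)
  rw [hπσ] at orbit_le
  calc iterKernel K T x z ≤ 2 * C * π z := by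
        linarith [iterKernel_orbit_sum hσ hMσ hK T x z, hupper x z]
    _ = 8 * L * C / θ * (θ * π z / (4 * L)) := by field_simp; ring
    _ ≤ 8 * L * C / θ * iterKernel K T y z := mul_le_mul_of_nonneg_left (lower y) (by positivity)

/-- The factor within which the rows of products of perturbed kernels are comparable in
`mergingTime_le_of_faberKrahn`. -/
noncomputable def comparisonFactor (θ L v : ℝ) : ℝ := 8 * L * max (4 / v) 1 / θ

/-- The constant of `mergingTime_le_of_faberKrahn`. -/
noncomputable def mergingConst (θ L p Λ v : ℝ) : ℝ :=
  (2 + comparisonFactor θ L v + comparisonFactor θ L v * Real.log (comparisonFactor θ L v)) *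
    (7 + 2 * (4 ^ p * Λ / (p * θ)))

lemma one_le_comparisonFactor {θ v : ℝ} (hθ0 : 0 < θ) (hθ1 : θ ≤ 1) (hL : 1 ≤ L) :
    1 ≤ comparisonFactor θ L v := by
  rw [comparisonFactor, le_div_iff₀ hθ0]
  nlinarith [le_max_right (4 / v) 1]

lemma mergingConst_pos {θ p Λ v : ℝ} (hθ0 : 0 < θ) (hθ1 : θ ≤ 1) (hL : 1 ≤ L) (hp : 0 < p)
    (hΛ : 0 ≤ Λ) : 0 < mergingConst θ L p Λ v := by
  have one_le := one_le_comparisonFactor (v := v) hθ0 hθ1 hL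
  have := Real.log_nonneg one_le
  rw [mergingConst]
  positivity

lemma mergingTime_le_of_faberKrahn (hM : IsReversible M π) {θ : ℝ} (hθ0 : 0 < θ)
    (hθ : ∀ x, θ ≤ M x x) (hL : 1 ≤ L) (hσ : Function.Involutive σ)
    (hMσ : ∀ x y, M (σ x) (σ y) = M x y) (hπσ : ∀ x, π (σ x) = π x) (hσo : σ o = o)
    (hW : HasUnitDrift {M} o W) (hW0 : ∀ x, 0 ≤ W x) {G : ℝ} (hG : 1 ≤ G) (hWG : ∀ x, W x ≤ G)
    {p Λ v : ℝ} (hp : 0 < p) (hΛ : 0 < Λ) (hv : 0 < v) (hFK : FaberKrahn M π p (Λ * G) v)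
    (hK : DrivenBy (orbitPerturbations M o σ L) K) {η : ℝ} (hη : 0 < η) :
    (mergingTime K η : ℝ≥0∞) ≤
      ENNReal.ofReal (mergingConst θ L p Λ v * (G * (1 + Real.posLog (1 / η)))) := by
  have G_pos : 0 < G := one_pos.trans_le hG
  set b := 4 ^ p * Λ / (p * θ) with b_def
  have : 0 < b := by positivity
  set n := ⌈(5 / 2 + b) * G⌉₊
  have le_n : (5 / 2 + b) * G ≤ n := Nat.le_ceil _
  have n_le : (n : ℝ) ≤ (5 / 2 + b) * G + 1 := (Nat.ceil_lt_add_one (by positivity)).le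
  have upper (x z : V) : (M ^ (n + n)) x z ≤ max (4 / v) 1 * π z := by
    refine hFK.pow_add_self_le hM hp (by positivity) hv hθ0 hθ ?_ x z
    calc 4 ^ p * (Λ * G) = p * θ * (b * G) := by rw [b_def]; field_simp
      _ ≤ p * θ * ((5 / 2 + b) * G) := by gcongr; linarith
      _ ≤ p * θ * n := by gcongr
  have time_ge : 4 * G + 1 ≤ ((n + n : ℕ) : ℝ) := by
    have : 0 ≤ b * G := by positivity
    push_cast
    linarith
  have time_le : ((n + n : ℕ) : ℝ) ≤ (7 + 2 * b) * G := by
    push_cast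
    linarith
  have θ_le_one := (hθ o).trans (le_one_of_mem_rowStochastic hM.stochastic)
  have factor_ge := one_le_comparisonFactor (v := v) hθ0 θ_le_one hL
  have log_nonneg := Real.log_nonneg factor_ge
  have posLog_nonneg : 0 ≤ Real.posLog (1 / η) := Real.posLog_nonneg
  have comparable : ComparableRows _ (n + n) (comparisonFactor θ L v) :=
    comparableRows_orbitPerturbations hM hθ0 hθ hL hσ hMσ hπσ hσo hW hW0 G_pos hWG time_ge
      (by positivity) upper
  refine (comparable.mergingTime_le orbitPerturbations_subset factor_ge hK hη).trans
    (ENNReal.ofReal_le_ofReal ?_)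
  rw [mergingConst, ← b_def, mul_assoc, ← mul_assoc (7 + _)]
  gcongr

end OrbitPerturbation

section Metropolis

variable {V : Type*} [Fintype V] [DecidableEq V] {Q : Matrix V V ℝ} {π w : V → ℝ}

lemma metropolis_apply_of_ne {x y : V} (hyx : y ≠ x) :
    metropolis Q π x y = Q x y * min 1 (π y / π x) :=
  if_neg hyx

lemma metropolis_apply_self (x : V) :
    metropolis Q π x x = 1 - ∑ z ∈ univ.erase x, Q x z * min 1 (π z / π x) :=
  if_pos rfl

lemma sum_metropolis (x : V) : ∑ y, metropolis Q π x y = 1 := by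
  rw [← add_sum_erase _ _ (mem_univ x), metropolis_apply_self,
    sum_congr rfl fun y hy => metropolis_apply_of_ne (ne_of_mem_erase hy), sub_add_cancel]

lemma mul_metropolis_of_ne {x y : V} (hx : 0 < π x) (hyx : y ≠ x) :
    π x * metropolis Q π x y = Q x y * min (π x) (π y) := by
  rw [metropolis_apply_of_ne hyx, mul_left_comm, mul_min_of_nonneg _ _ hx.le, mul_one,
    mul_div_cancel₀ _ hx.ne']

lemma apply_self_le_metropolis (hQ : Q ∈ rowStochastic ℝ V) (x : V) :
    Q x x ≤ metropolis Q π x x := by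
  have rejected : ∑ z ∈ univ.erase x, Q x z * min 1 (π z / π x) ≤ ∑ z ∈ univ.erase x, Q x z :=
    sum_le_sum fun z _ =>
      mul_le_of_le_one_right (nonneg_of_mem_rowStochastic hQ) (min_le_left _ _)
  have row_sum := add_sum_erase univ (Q x) (mem_univ x)
  rw [sum_row_of_mem_rowStochastic hQ] at row_sum
  rw [metropolis_apply_self]
  linarith

lemma metropolis_mem_rowStochastic (hQ : Q ∈ rowStochastic ℝ V) (hπ : ∀ x, 0 ≤ π x) :
    metropolis Q π ∈ rowStochastic ℝ V := by
  refine mem_rowStochastic_iff_sum.2 ⟨fun x y => ?_, sum_metropolis⟩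
  rcases eq_or_ne y x with rfl | hyx
  · exact (nonneg_of_mem_rowStochastic hQ).trans (apply_self_le_metropolis hQ y)
  · rw [metropolis_apply_of_ne hyx]
    exact mul_nonneg (nonneg_of_mem_rowStochastic hQ)
      (le_min zero_le_one (div_nonneg (hπ y) (hπ x)))

lemma isReversible_metropolis (hQ : Q ∈ rowStochastic ℝ V) (hQsymm : Q.IsSymm)
    (hπ : ∀ x, 0 < π x) (hπ1 : ∑ x, π x = 1) : IsReversible (metropolis Q π) π where
  stochastic := metropolis_mem_rowStochastic hQ fun x => (hπ x).le
  pos := hπ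
  sum_eq_one := hπ1
  detailed_balance x y := by
    rcases eq_or_ne y x with rfl | hyx
    · rfl
    · rw [mul_metropolis_of_ne (hπ x) hyx, mul_metropolis_of_ne (hπ y) hyx.symm, hQsymm.apply,
        min_comm]

lemma metropolis_apply_perm {σ : Equiv.Perm V} (hQσ : ∀ x y, Q (σ x) (σ y) = Q x y)
    (hπσ : ∀ x, π (σ x) = π x) (x y : V) :
    metropolis Q π (σ x) (σ y) = metropolis Q π x y := by
  rcases eq_or_ne y x with rfl | hyx
  · rw [metropolis_apply_self, metropolis_apply_self]
    congr 1
    refine (sum_equiv σ (fun z => ?_) fun z _ => ?_).symm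
    · simp only [mem_erase, mem_univ, and_true, ne_eq, EmbeddingLike.apply_eq_iff_eq]
    · rw [hQσ, hπσ, hπσ]
  · rw [metropolis_apply_of_ne hyx, metropolis_apply_of_ne (σ.injective.ne hyx), hQσ, hπσ, hπσ]

lemma mul_metropolis_mulVec_sub {x : V} (hx : 0 < π x) (f : V → ℝ) :
    π x * ((metropolis Q π *ᵥ f) x - f x)
      = ∑ y, Q x y * (min (π x) (π y) * (f y - f x)) := by
  have increment : (metropolis Q π *ᵥ f) x - f x = ∑ y, metropolis Q π x y * (f y - f x) := by
    simp only [mulVec, dotProduct, mul_sub, sum_sub_distrib, ← sum_mul, sum_metropolis, one_mul]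
  rw [increment, mul_sum]
  refine sum_congr rfl fun y _ => ?_
  rcases eq_or_ne y x with rfl | hyx
  · simp only [sub_self, mul_zero]
  · rw [← mul_assoc, mul_metropolis_of_ne hx hyx, mul_assoc]

omit [DecidableEq V] in
lemma normalized_pos (hw : ∀ x, 0 < w x) (x : V) : 0 < normalized w x :=
  div_pos (hw x) (sum_pos (fun y _ => hw y) ⟨x, mem_univ x⟩)

omit [DecidableEq V] in
lemma sum_normalized (hw : ∑ x, w x ≠ 0) : ∑ x, normalized w x = 1 := by
  simp only [normalized, ← sum_div, div_self hw]

lemma metropolis_normalized (hw : ∑ x, w x ≠ 0) :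
    metropolis Q (normalized w) = metropolis Q w := by
  simp only [metropolis, normalized, div_div_div_cancel_right₀ hw]

end Metropolis

section Segment

variable {N : ℕ}

/-- The reflection `x ↦ -x` of `V_N`. -/
def reflect (N : ℕ) : Equiv.Perm (Vtx N) where
  toFun x := ⟨-x, by have := mem_Icc.1 x.2; exact mem_Icc.2 (by omega)⟩
  invFun x := ⟨-x, by have := mem_Icc.1 x.2; exact mem_Icc.2 (by omega)⟩
  left_inv x := Subtype.ext (neg_neg x.1)
  right_inv x := Subtype.ext (neg_neg x.1)

lemma coe_reflect (x : Vtx N) : (reflect N x : ℤ) = -x := rfl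

lemma reflect_involutive : Function.Involutive (reflect N) := fun x => Subtype.ext (neg_neg x.1)

/-- The middle vertex `0` of `V_N`. -/
def mid (N : ℕ) : Vtx N := ⟨0, mem_Icc.2 (by omega)⟩

lemma reflect_mid : reflect N (mid N) = mid N := rfl

lemma natAbs_le (x : Vtx N) : x.1.natAbs ≤ N := by
  have := mem_Icc.1 x.2
  omega

lemma sum_vtx_ite_eq (c : ℤ) (g : ℤ → ℝ) :
    ∑ y : Vtx N, (if y.1 = c then g y else 0) = if c.natAbs ≤ N then g c else 0 := by
  rw [sum_coe_sort (Icc (-(N : ℤ)) N) fun y => if y = c then g y else 0, sum_ite_eq']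
  exact if_congr (by rw [mem_Icc]; omega) rfl rfl

lemma sum_baseWalk_mul (x : Vtx N) (g : ℤ → ℝ) :
    ∑ y : Vtx N, baseWalk N x y * g y = baseWalk N x x * g x
      + ((if (x.1 - 1).natAbs ≤ N then g (x - 1) else 0)
        + if (x.1 + 1).natAbs ≤ N then g (x + 1) else 0) / 3 := by
  have split_neighbors (y : Vtx N) : baseWalk N x y * g y
      = (if y = x then baseWalk N x x * g x else 0)
        + ((if y.1 = x - 1 then g y else 0) + if y.1 = x + 1 then g y else 0) / 3 := by
    rcases eq_or_ne y x with rfl | hyx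
    · simp [show y.1 ≠ y.1 - 1 by omega]
    · have adjacent_iff : |x.1 - y.1| = 1 ↔ y.1 = x - 1 ∨ y.1 = x + 1 := by
        rw [abs_eq one_pos.le]
        omega
      simp only [baseWalk, of_apply, if_neg hyx, adjacent_iff]
      split_ifs <;> first | omega | ring
  rw [sum_congr rfl fun y _ => split_neighbors y]
  simp only [sum_add_distrib, ← sum_div, sum_vtx_ite_eq, sum_ite_eq', mem_univ, if_true]

lemma sum_baseWalk_mul_radial {x : Vtx N} {a : ℕ} (hx : x.1.natAbs = a + 1) {h : ℕ → ℝ}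
    (hx0 : h (a + 1) = 0) :
    ∑ y : Vtx N, baseWalk N x y * h y.1.natAbs
      = (h a + if a + 2 ≤ N then h (a + 2) else 0) / 3 := by
  have := natAbs_le x
  rw [sum_baseWalk_mul x fun y => h y.natAbs, hx, hx0, mul_zero, zero_add]
  rcases Int.natAbs_eq x.1 with hpos | hneg
  · rw [show (x.1 - 1).natAbs = a by omega, show (x.1 + 1).natAbs = a + 2 by omega,
      if_pos (by omega)]
  · rw [show (x.1 - 1).natAbs = a + 2 by omega, show (x.1 + 1).natAbs = a by omega,
      if_pos (show a ≤ N by omega), add_comm]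

lemma baseWalk_isSymm (N : ℕ) : (baseWalk N).IsSymm := by
  refine IsSymm.ext fun x y => ?_
  rcases eq_or_ne x y with rfl | hxy
  · rfl
  · simp only [baseWalk, of_apply, if_neg hxy, if_neg hxy.symm, abs_sub_comm]

lemma third_le_baseWalk_self (x : Vtx N) : 1 / 3 ≤ baseWalk N x x := by
  simp only [baseWalk, of_apply, if_true]
  split_ifs <;> norm_num

lemma baseWalk_of_adj {x y : Vtx N} (hxy : |x.1 - y.1| = 1) : baseWalk N x y = 1 / 3 := by
  have hyx : y ≠ x := by
    rintro rfl
    simp at hxy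
  simp only [baseWalk, of_apply, if_neg hyx, if_pos hxy]

lemma baseWalk_mem_rowStochastic (hN : 1 ≤ N) : baseWalk N ∈ rowStochastic ℝ (Vtx N) := by
  refine mem_rowStochastic_iff_sum.2 ⟨fun x y => ?_, fun x => ?_⟩
  · simp only [baseWalk, of_apply]
    split_ifs <;> norm_num
  · have row_sum := sum_baseWalk_mul x fun _ => 1
    simp only [mul_one] at row_sum
    have := natAbs_le x
    rw [row_sum, baseWalk, of_apply, if_pos rfl, Int.abs_eq_natAbs]
    split_ifs <;> first | omega | norm_num

lemma baseWalk_reflect (x y : Vtx N) :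
    baseWalk N (reflect N x) (reflect N y) = baseWalk N x y := by
  simp only [baseWalk, of_apply, EmbeddingLike.apply_eq_iff_eq, coe_reflect, abs_neg, neg_sub_neg,
    abs_sub_comm]

end Segment

section MidPerturbation

variable {N : ℕ} {M P : Matrix (Vtx N) (Vtx N) ℝ} {ε s : ℝ}

lemma sum_midPerturb (hN : 1 ≤ N) (s : ℝ) (x : Vtx N) : ∑ y, midPerturb N s x y = 0 := by
  by_cases hx : x.1 = 0
  · have split_neighbors (y : Vtx N) : midPerturb N s x y
        = (if y.1 = 1 then s else 0) + if y.1 = -1 then -s else 0 := by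
      simp only [midPerturb, of_apply, hx, true_and]
      split_ifs <;> first | omega | simp
    simp only [split_neighbors, sum_add_distrib, sum_vtx_ite_eq _ fun _ => s,
      sum_vtx_ite_eq _ fun _ => -s]
    simp [hN]
  · simp [midPerturb, hx]

lemma midPerturb_of_ne_mid {x : Vtx N} (hx : x ≠ mid N) : midPerturb N s x = 0 := by
  ext y
  exact (if_neg fun h => hx (Subtype.ext h.1)).trans (if_neg fun h => hx (Subtype.ext h.1))

lemma apply_mid_le_two_mul (hM : M ∈ rowStochastic ℝ (Vtx N))
    (hε : ∀ y : Vtx N, y.1.natAbs = 1 → 2 * ε ≤ M (mid N) y) (hs : s ∈ Set.Icc (-ε) ε)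
    (z : Vtx N) : M (mid N) z ≤ 2 * (M + midPerturb N s) (mid N) z := by
  obtain ⟨neg_le, le⟩ := hs
  have : 0 ≤ M (mid N) z := nonneg_of_mem_rowStochastic hM
  simp only [Matrix.add_apply, midPerturb, of_apply]
  split_ifs with h1 h2
  · linarith [hε z (by omega)]
  · linarith [hε z (by omega)]
  · linarith

lemma isOrbitPerturbation_of_mem_perturbSet (hN : 1 ≤ N) (hM : M ∈ rowStochastic ℝ (Vtx N))
    (hε : ∀ y : Vtx N, y.1.natAbs = 1 → 2 * ε ≤ M (mid N) y) (hP : P ∈ perturbSet M ε) :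
    IsOrbitPerturbation M (mid N) (reflect N) 2 P := by
  obtain ⟨s, hs, rfl⟩ := hP
  have half_le := apply_mid_le_two_mul hM hε hs
  have row_eq (x : Vtx N) (hx : x ≠ mid N) : (M + midPerturb N s) x = M x := by
    change M x + midPerturb N s x = M x
    rw [midPerturb_of_ne_mid hx, add_zero]
  refine ⟨mem_rowStochastic_iff_sum.2 ⟨fun x y => ?_, fun x => ?_⟩, row_eq, fun z => ?_, half_le⟩
  · have entry_nonneg (x) : 0 ≤ M x y := nonneg_of_mem_rowStochastic hM
    rcases eq_or_ne x (mid N) with rfl | hx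
    · linarith [half_le y, entry_nonneg (mid N)]
    · rw [row_eq x hx]
      exact entry_nonneg x
  · simp only [Matrix.add_apply, sum_add_distrib, sum_row_of_mem_rowStochastic hM,
      sum_midPerturb hN, add_zero]
  · simp only [Matrix.add_apply, midPerturb, of_apply, coe_reflect, mid, true_and]
    split_ifs <;> first | omega | ring

end MidPerturbation

section HitTime

variable {N : ℕ} {u : ℕ → ℝ}

/-- The mean time that the Metropolis chain with base `baseWalk N` and target proportional to the
radial weight `u |x|` takes to reach the middle vertex from distance `r`. -/
noncomputable def hitTime (u : ℕ → ℝ) (N r : ℕ) : ℝ :=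
  ∑ a ∈ range r, 3 * (∑ b ∈ Ico (a + 1) (N + 1), u b) / min (u a) (u (a + 1))

lemma hitTime_succ_sub (u : ℕ → ℝ) (N r : ℕ) : hitTime u N (r + 1) - hitTime u N r
    = 3 * (∑ b ∈ Ico (r + 1) (N + 1), u b) / min (u r) (u (r + 1)) := by
  rw [hitTime, sum_range_succ, hitTime, add_sub_cancel_left]

lemma hitTime_summand_nonneg (hu : ∀ a ≤ N, 0 < u a) {a : ℕ} (ha : a < N) :
    0 ≤ 3 * (∑ b ∈ Ico (a + 1) (N + 1), u b) / min (u a) (u (a + 1)) :=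
  div_nonneg (mul_nonneg three_pos.le (sum_nonneg fun b hb =>
    (hu b (Nat.lt_succ_iff.1 (mem_Ico.1 hb).2)).le)) (le_min (hu a ha.le).le (hu (a + 1) ha).le)

lemma hitTime_nonneg (hu : ∀ a ≤ N, 0 < u a) {r : ℕ} (hr : r ≤ N) : 0 ≤ hitTime u N r :=
  sum_nonneg fun _ ha => hitTime_summand_nonneg hu ((mem_range.1 ha).trans_le hr)

lemma hitTime_mono (hu : ∀ a ≤ N, 0 < u a) {r : ℕ} (hr : r ≤ N) : hitTime u N r ≤ hitTime u N N :=
  sum_le_sum_of_subset_of_nonneg (range_mono hr)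
    fun _ ha _ => hitTime_summand_nonneg hu (mem_range.1 ha)

lemma metropolis_mulVec_hitTime (hu : ∀ a ≤ N, 0 < u a) {x : Vtx N} (hx : x ≠ mid N) :
    (metropolis (baseWalk N) (fun y => u y.1.natAbs) *ᵥ fun y => hitTime u N y.1.natAbs) x
      = hitTime u N x.1.natAbs - 1 := by
  obtain ⟨a, ha⟩ : ∃ a, x.1.natAbs = a + 1 := Nat.exists_eq_add_one_of_ne_zero
    fun h => hx (Subtype.ext (Int.natAbs_eq_zero.1 h))
  have a_lt : a + 1 ≤ N := ha ▸ natAbs_le x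
  have ux_pos : 0 < u (a + 1) := hu _ a_lt
  have inward : min (u (a + 1)) (u a) * (hitTime u N a - hitTime u N (a + 1))
      = -(3 * ∑ b ∈ Ico (a + 1) (N + 1), u b) := by
    rw [← neg_sub, hitTime_succ_sub, min_comm, mul_neg,
      mul_div_cancel₀ _ (lt_min (hu a (by omega)) ux_pos).ne']
  have outward : (if a + 2 ≤ N then
        min (u (a + 1)) (u (a + 2)) * (hitTime u N (a + 2) - hitTime u N (a + 1)) else 0)
      = 3 * ∑ b ∈ Ico (a + 2) (N + 1), u b := by
    split_ifs with h
    · rw [hitTime_succ_sub, mul_div_cancel₀ _ (lt_min ux_pos (hu (a + 2) h)).ne']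
    · rw [Ico_eq_empty (by omega), sum_empty, mul_zero]
  have drift := mul_metropolis_mulVec_sub (Q := baseWalk N) (π := fun y => u y.1.natAbs)
    (x := x) (by simpa only [ha] using ux_pos) fun y => hitTime u N y.1.natAbs
  rw [sum_baseWalk_mul_radial ha
      (h := fun b => min (u x.1.natAbs) (u b) * (hitTime u N b - hitTime u N x.1.natAbs))
      (by rw [ha, sub_self, mul_zero]), ha, inward, outward,
    sum_eq_sum_Ico_succ_bot (Nat.lt_succ_of_le a_lt)] at drift
  rw [ha]
  have := mul_left_cancel₀ ux_pos.ne' (drift.trans (c := u (a + 1) * (-1)) (by ring))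
  linarith

end HitTime

section RadialProfile

variable {N : ℕ} {ρ : ℕ → ℕ} {α : ℝ}

/-- An integer profile `ρ` on the distances `0, …, N` to the middle vertex, injective with values in
`1, …, N + 1`, such that from every distance one can move inward or outward by `N / 3` steps without
`ρ` falling below half of its initial value. -/
structure IsRadialProfile (N : ℕ) (ρ : ℕ → ℕ) : Prop where
  one_le : ∀ a ≤ N, 1 ≤ ρ a
  le : ∀ a ≤ N, ρ a ≤ N + 1
  injOn : Set.InjOn ρ (Set.Iic N)
  move : ∀ k a, 3 * k ≤ N → a ≤ N →
    (a + k ≤ N ∧ ∀ j ≤ k, ρ a ≤ 2 * ρ (a + j)) ∨ (k ≤ a ∧ ∀ j ≤ k, ρ a ≤ 2 * ρ (a - j))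

lemma isRadialProfile_sub_add_one (N : ℕ) : IsRadialProfile N fun a => N - a + 1 where
  one_le a _ := by omega
  le a _ := by omega
  injOn a ha b hb hab := by
    simp only [Set.mem_Iic] at ha hb hab
    omega
  move k a hk ha := by
    rcases le_or_gt k a with hka | hka
    · exact Or.inr ⟨hka, fun j hj => by omega⟩
    · exact Or.inl ⟨by omega, fun j hj => by omega⟩

lemma isRadialProfile_add_one (N : ℕ) : IsRadialProfile N fun a => a + 1 where
  one_le a _ := by omega
  le a _ := by omega
  injOn _ _ _ _ hab := Nat.succ_injective hab
  move k a hk ha := by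
    rcases le_or_gt (a + k) N with hka | hka
    · exact Or.inl ⟨hka, fun j _ => by omega⟩
    · exact Or.inr ⟨by omega, fun j hj => by omega⟩

/-- The weight `ρ(|x|)^α` on `V_N`. -/
noncomputable def radialWeight (ρ : ℕ → ℕ) (α : ℝ) {N : ℕ} (x : Vtx N) : ℝ :=
  (ρ x.1.natAbs : ℝ) ^ α

lemma radialWeight_reflect (x : Vtx N) :
    radialWeight ρ α (reflect N x) = radialWeight ρ α x := by
  rw [radialWeight, coe_reflect, Int.natAbs_neg, radialWeight]

namespace IsRadialProfile

lemma rpow_pos (hρ : IsRadialProfile N ρ) (α : ℝ) {a : ℕ} (ha : a ≤ N) : 0 < (ρ a : ℝ) ^ α :=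
  Real.rpow_pos_of_pos (Nat.cast_pos.2 (hρ.one_le a ha)) α

lemma radialWeight_pos (hρ : IsRadialProfile N ρ) (α : ℝ) (x : Vtx N) : 0 < radialWeight ρ α x :=
  hρ.rpow_pos α (natAbs_le x)

lemma sum_radialWeight_pos (hρ : IsRadialProfile N ρ) (α : ℝ) :
    0 < ∑ x : Vtx N, radialWeight ρ α x :=
  sum_pos (fun x _ => hρ.radialWeight_pos α x) ⟨mid N, mem_univ _⟩

end IsRadialProfile

lemma card_filter_natAbs_le (S : Finset (Vtx N)) (a : ℕ) : #{x ∈ S | x.1.natAbs = a} ≤ 2 := by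
  refine (card_le_card_of_injOn (t := ({(a : ℤ), -(a : ℤ)} : Finset ℤ)) (fun x => x.1)
    (fun x hx => ?_) Subtype.val_injective.injOn).trans card_le_two
  have := (mem_filter.1 hx).2
  simp only [coe_insert, coe_singleton, Set.mem_insert_iff, Set.mem_singleton_iff]
  omega

/-- The constant in the volume growth `π(S) ≥ c (|S| / N)^(1 + α)` of radial weights. -/
noncomputable def volumeConst (α : ℝ) : ℝ := 1 / (6 * 8 ^ α)

namespace IsRadialProfile

lemma card_filter_le (hρ : IsRadialProfile N ρ) (S : Finset (Vtx N)) (j : ℕ) :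
    #{x ∈ S | ρ x.1.natAbs ≤ j} ≤ 2 * j := by
  set T := {x ∈ S | ρ x.1.natAbs ≤ j}
  have image_card : #(T.image fun x => ρ x.1.natAbs) ≤ j := by
    have : (T.image fun x => ρ x.1.natAbs) ⊆ Icc 1 j := image_subset_iff.2 fun x hx =>
      mem_Icc.2 ⟨hρ.one_le _ (natAbs_le x), (mem_filter.1 hx).2⟩
    simpa using card_le_card this
  have fibre_card : ∀ r ∈ T.image fun x => ρ x.1.natAbs, #{x ∈ T | ρ x.1.natAbs = r} ≤ 2 := by
    simp only [forall_mem_image]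
    intro x _
    refine (card_le_card fun y hy => ?_).trans (card_filter_natAbs_le T x.1.natAbs)
    obtain ⟨hyT, hyx⟩ := mem_filter.1 hy
    exact mem_filter.2 ⟨hyT, hρ.injOn (natAbs_le y) (natAbs_le x) hyx⟩
  exact (card_le_mul_card_image T 2 fibre_card).trans (Nat.mul_le_mul_left 2 image_card)

lemma half_card_mul_le_sum (hρ : IsRadialProfile N ρ) (hα : 0 ≤ α) (S : Finset (Vtx N)) :
    (#S : ℝ) / 2 * (#S / 4 : ℝ) ^ α ≤ ∑ x ∈ S, radialWeight ρ α x := by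
  set T := {x ∈ S | #S / 4 < ρ x.1.natAbs}
  have half_le : (#S : ℝ) / 2 ≤ #T := by
    have small := hρ.card_filter_le S (#S / 4)
    have cover : #S ≤ #({x ∈ S | ρ x.1.natAbs ≤ #S / 4} ∪ T) :=
      card_le_card fun x hx => by simpa [T, hx] using le_or_gt _ _
    have := cover.trans (card_union_le _ _)
    have card_le : #S ≤ 2 * #T := by omega
    rw [div_le_iff₀' two_pos]
    exact_mod_cast card_le
  calc (#S : ℝ) / 2 * (#S / 4 : ℝ) ^ α ≤ #T * (#S / 4 : ℝ) ^ α := by gcongr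
    _ ≤ ∑ x ∈ T, radialWeight ρ α x := by
        rw [← nsmul_eq_mul]
        refine card_nsmul_le_sum _ _ _ fun x hx => Real.rpow_le_rpow (by positivity) ?_ hα
        have : #S / 4 < ρ x.1.natAbs := (mem_filter.1 hx).2
        have card_le : #S ≤ 4 * ρ x.1.natAbs := by omega
        rw [div_le_iff₀' four_pos]
        exact_mod_cast card_le
    _ ≤ ∑ x ∈ S, radialWeight ρ α x :=
        sum_le_sum_of_subset_of_nonneg (filter_subset _ _) fun x _ _ =>
          (hρ.radialWeight_pos α x).le

lemma sum_radialWeight_le (hρ : IsRadialProfile N ρ) (hα : 0 ≤ α) (hN : 1 ≤ N) :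
    ∑ x : Vtx N, radialWeight ρ α x ≤ 3 * N * (2 * N : ℝ) ^ α := by
  have one_le : (1 : ℝ) ≤ N := by exact_mod_cast hN
  have card_eq : #(univ : Finset (Vtx N)) = 2 * N + 1 := by
    rw [card_univ, Fintype.card_coe, Int.card_Icc]
    omega
  calc ∑ x : Vtx N, radialWeight ρ α x ≤ #(univ : Finset (Vtx N)) • (2 * N : ℝ) ^ α := by
        refine sum_le_card_nsmul _ _ _ fun x _ => Real.rpow_le_rpow (Nat.cast_nonneg _) ?_ hα
        have : (ρ x.1.natAbs : ℝ) ≤ N + 1 := by exact_mod_cast hρ.le _ (natAbs_le x)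
        linarith
    _ = (2 * N + 1) * (2 * N : ℝ) ^ α := by rw [nsmul_eq_mul, card_eq]; norm_cast
    _ ≤ 3 * N * (2 * N : ℝ) ^ α := by gcongr; linarith

lemma volume_growth (hρ : IsRadialProfile N ρ) (hα : 0 ≤ α) (hN : 1 ≤ N) (S : Finset (Vtx N)) :
    volumeConst α / (N : ℝ) ^ (1 + α) * (#S : ℝ) ^ (1 + α)
      ≤ ∑ x ∈ S, normalized (radialWeight ρ α) x := by
  have N_pos : (0 : ℝ) < N := by exact_mod_cast hN
  have lower := hρ.half_card_mul_le_sum hα S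
  have upper := hρ.sum_radialWeight_le hα hN
  simp only [normalized, ← sum_div]
  refine le_trans (le_of_eq ?_) (div_le_div₀ ((by positivity : (0 : ℝ) ≤ _).trans lower) lower
    (hρ.sum_radialWeight_pos α) upper)
  rw [volumeConst, Real.rpow_add N_pos, Real.rpow_add' (Nat.cast_nonneg _) (by positivity),
    Real.rpow_one, Real.rpow_one, Real.div_rpow (Nat.cast_nonneg _) four_pos.le,
    Real.mul_rpow two_pos.le N_pos.le, show (8 : ℝ) = 2 * 4 by norm_num,
    Real.mul_rpow two_pos.le four_pos.le]
  field_simp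
  ring

end IsRadialProfile

lemma exists_isPathFamily_metropolis {π : Vtx N → ℝ} (hπ : ∀ x, 0 < π x) {k : ℕ} {b : ℝ}
    (hb : 0 < b) (h : ∀ x : Vtx N, ∃ s : ℤ, (s = 1 ∨ s = -1) ∧
      ∀ j : ℕ, j ≤ k → ∃ y : Vtx N, y.1 = x.1 + s * j ∧ π x ≤ b * π y) :
    ∃ γ, IsPathFamily (metropolis (baseWalk N) π) π k 2 (3 * b) γ := by
  choose s hs line using h
  choose! γ γ_val le_γ using line
  refine ⟨γ, ⟨fun x => ?_, fun x i hi j hj hij => ?_, fun x j hj => ?_, fun j hj u => ?_⟩⟩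
  · exact Subtype.ext (by simpa using γ_val x 0 k.zero_le)
  · have val_eq := (γ_val x i hi).symm.trans ((congrArg Subtype.val hij).trans (γ_val x j hj))
    rcases hs x with h | h <;> rw [h] at val_eq <;> omega
  · have val_sub : (γ x (j + 1)).1 - (γ x j).1 = s x := by
      rw [γ_val x j hj.le, γ_val x (j + 1) hj]
      push_cast
      ring
    have adj : |(γ x j).1 - (γ x (j + 1)).1| = 1 := by
      rw [abs_sub_comm, val_sub]
      rcases hs x with h | h <;> simp [h]
    have ne : γ x (j + 1) ≠ γ x j := fun h => by simp [h] at adj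
    calc π x ≤ min (b * π (γ x j)) (b * π (γ x (j + 1))) :=
          le_min (le_γ x j hj.le) (le_γ x (j + 1) hj)
      _ = 3 * b * (π (γ x j) * metropolis (baseWalk N) π (γ x j) (γ x (j + 1))) := by
          rw [mul_metropolis_of_ne (hπ _) ne, baseWalk_of_adj adj, ← mul_min_of_nonneg _ _ hb.le]
          ring
  · refine (card_le_card_of_injOn (t := ({u.1 - j, u.1 + j} : Finset ℤ)) (fun x => x.1)
      (fun x hx => ?_) Subtype.val_injective.injOn).trans card_le_two
    have val_eq := γ_val x j hj.le
    rw [(mem_filter.1 hx).2] at val_eq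
    simp only [coe_insert, coe_singleton, Set.mem_insert_iff, Set.mem_singleton_iff]
    rcases hs x with h | h <;> rw [h] at val_eq <;> omega

namespace IsRadialProfile

lemma exists_direction (hρ : IsRadialProfile N ρ) {k : ℕ} (hk : 3 * k ≤ N) (x : Vtx N) :
    ∃ s : ℤ, (s = 1 ∨ s = -1) ∧
      ∀ j ≤ k, ∃ y : Vtx N, y.1 = x.1 + s * j ∧ ρ x.1.natAbs ≤ 2 * ρ y.1.natAbs := by
  have := natAbs_le x
  obtain ⟨t, ht, hx⟩ : ∃ t : ℤ, (t = 1 ∨ t = -1) ∧ x.1 = t * x.1.natAbs := by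
    rcases le_total 0 x.1 with h | h
    · exact ⟨1, Or.inl rfl, by omega⟩
    · exact ⟨-1, Or.inr rfl, by omega⟩
  rcases hρ.move k x.1.natAbs hk (natAbs_le x) with ⟨le_N, le_ρ⟩ | ⟨le_abs, le_ρ⟩
  · refine ⟨t, ht, fun j hj => ?_⟩
    have abs_eq : (x.1 + t * j).natAbs = x.1.natAbs + j := by rcases ht with rfl | rfl <;> omega
    exact ⟨⟨x.1 + t * j, mem_Icc.2 (by omega)⟩, rfl, by simpa only [abs_eq] using le_ρ j hj⟩
  · refine ⟨-t, by omega, fun j hj => ?_⟩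
    have abs_eq : (x.1 + -t * j).natAbs = x.1.natAbs - j := by
      rcases ht with rfl | rfl <;> omega
    exact ⟨⟨x.1 + -t * j, mem_Icc.2 (by omega)⟩, rfl, by simpa only [abs_eq] using le_ρ j hj⟩

lemma normalized_radialWeight_le (hρ : IsRadialProfile N ρ) (hα : 0 ≤ α) {x y : Vtx N}
    (hxy : ρ x.1.natAbs ≤ 2 * ρ y.1.natAbs) :
    normalized (radialWeight ρ α) x ≤ 2 ^ α * normalized (radialWeight ρ α) y := by
  rw [normalized, normalized, mul_div_assoc', radialWeight, radialWeight,
    ← Real.mul_rpow two_pos.le (Nat.cast_nonneg _)]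
  exact div_le_div_of_nonneg_right
    (Real.rpow_le_rpow (Nat.cast_nonneg _) (by exact_mod_cast hxy) hα)
    (hρ.sum_radialWeight_pos α).le

lemma isReversible (hρ : IsRadialProfile N ρ) (hN : 1 ≤ N) (α : ℝ) :
    IsReversible (metropolis (baseWalk N) (normalized (radialWeight ρ α)))
      (normalized (radialWeight ρ α)) :=
  isReversible_metropolis (baseWalk_mem_rowStochastic hN) (baseWalk_isSymm N)
    (normalized_pos (hρ.radialWeight_pos α)) (sum_normalized (hρ.sum_radialWeight_pos α).ne')

end IsRadialProfile

/-- The constant `Λ` of the Faber–Krahn inequality `IsRadialProfile.faberKrahn`. -/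
noncomputable def faberKrahnConst (α : ℝ) : ℝ :=
  12 * 2 ^ α * (volumeConst α ^ (2 / (1 + α)))⁻¹

lemma volumeConst_pos (α : ℝ) : 0 < volumeConst α := by
  rw [volumeConst]
  positivity

lemma faberKrahnConst_pos (α : ℝ) : 0 < faberKrahnConst α := by
  have := volumeConst_pos α
  rw [faberKrahnConst]
  positivity

lemma IsRadialProfile.faberKrahn (hρ : IsRadialProfile N ρ) (hα : 0 ≤ α) (hN : 1 ≤ N) :
    FaberKrahn (metropolis (baseWalk N) (normalized (radialWeight ρ α)))
      (normalized (radialWeight ρ α)) (2 / (1 + α)) (faberKrahnConst α * (N : ℝ) ^ 2)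
      (volumeConst α * (1 / 3) ^ (1 + α)) := by
  have N_pos : (0 : ℝ) < N := by exact_mod_cast hN
  have D_pos : 0 < 1 + α := by linarith
  have vol_pos := volumeConst_pos α
  convert faberKrahn_of_pathFamily (m := 2) (B := 3 * 2 ^ α) (r := 1 / 3 * N)
    (hρ.isReversible hN α) (by positivity) (by positivity) D_pos (by positivity)
    (fun k hk => ?_) (hρ.volume_growth hα hN) using 1
  · rw [faberKrahnConst, Real.div_rpow vol_pos.le (by positivity),
      ← Real.rpow_mul N_pos.le, mul_div_cancel₀ _ D_pos.ne', Real.rpow_two, inv_div]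
    push_cast
    ring
  · rw [Real.mul_rpow (by positivity) N_pos.le]
    field_simp
  · have three_mul_le : 3 * k ≤ N := by
      rw [← Nat.cast_le (α := ℝ)]
      push_cast
      linarith
    refine exists_isPathFamily_metropolis (normalized_pos (hρ.radialWeight_pos α)) (by positivity)
      fun x => ?_
    obtain ⟨s, hs, line⟩ := hρ.exists_direction three_mul_le x
    refine ⟨s, hs, fun j hj => ?_⟩
    obtain ⟨y, hy, le_y⟩ := line j hj
    exact ⟨y, hy, hρ.normalized_radialWeight_le hα le_y⟩

end RadialProfile

section RadialMerging

variable {N : ℕ} {ρ : ℕ → ℕ} {α : ℝ}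

/-- The constant of `IsRadialProfile.mergingTime_le`: the merging constant of an orbit perturbation
with holding `1 / 3`, comparison factor `2` and dimension `1 + α`. -/
noncomputable def radialConst (α : ℝ) : ℝ :=
  mergingConst (1 / 3) 2 (2 / (1 + α)) (faberKrahnConst α) (volumeConst α * (1 / 3) ^ (1 + α))

lemma radialConst_pos (hα : 0 ≤ α) : 0 < radialConst α :=
  mergingConst_pos (by norm_num) (by norm_num) one_le_two (by positivity) (faberKrahnConst_pos α).le

namespace IsRadialProfile

lemma hasUnitDrift (hρ : IsRadialProfile N ρ) (α : ℝ) :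
    HasUnitDrift {metropolis (baseWalk N) (normalized (radialWeight ρ α))} (mid N)
      fun x => hitTime (fun a => (ρ a : ℝ) ^ α) N x.1.natAbs := by
  rintro P rfl x hx
  rw [metropolis_normalized (hρ.sum_radialWeight_pos α).ne']
  exact (metropolis_mulVec_hitTime (fun _ => hρ.rpow_pos α) hx).le

lemma two_mul_le_metropolis_mid (hρ : IsRadialProfile N ρ) {ε : ℝ}
    (hε : 6 * ε ≤ min 1 ((ρ 1 : ℝ) ^ α / (ρ 0 : ℝ) ^ α)) {y : Vtx N} (hy : y.1.natAbs = 1) :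
    2 * ε ≤ metropolis (baseWalk N) (normalized (radialWeight ρ α)) (mid N) y := by
  have adj : |(mid N).1 - y.1| = 1 := by
    rw [mid, zero_sub, abs_neg, Int.abs_eq_natAbs, hy, Nat.cast_one]
  have ne : y ≠ mid N := by
    rintro rfl
    simp at adj
  rw [metropolis_normalized (hρ.sum_radialWeight_pos α).ne', metropolis_apply_of_ne ne,
    baseWalk_of_adj adj, radialWeight, radialWeight, hy]
  change _ ≤ 1 / 3 * min 1 ((ρ 1 : ℝ) ^ α / (ρ 0 : ℝ) ^ α)
  linarith

theorem mergingTime_le (hρ : IsRadialProfile N ρ) (hα : 0 ≤ α) (hN : 1 ≤ N) {G : ℝ}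
    (hNG : (N : ℝ) ^ 2 ≤ G) (hG : hitTime (fun a => (ρ a : ℝ) ^ α) N N ≤ G) {ε : ℝ}
    (hε : 6 * ε ≤ min 1 ((ρ 1 : ℝ) ^ α / (ρ 0 : ℝ) ^ α)) {K : ℕ → Matrix (Vtx N) (Vtx N) ℝ}
    (hK : DrivenBy
      (perturbSet (metropolis (baseWalk N) (normalized (radialWeight ρ α))) ε) K)
    {η : ℝ} (hη : 0 < η) :
    (mergingTime K η : ℝ≥0∞) ≤
      ENNReal.ofReal (radialConst α * (G * (1 + Real.posLog (1 / η)))) := by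
  have weight_pos : ∀ a ≤ N, 0 < (ρ a : ℝ) ^ α := fun _ => hρ.rpow_pos α
  have symm (x : Vtx N) :
      normalized (radialWeight ρ α) (reflect N x) = normalized (radialWeight ρ α) x := by
    rw [normalized, radialWeight_reflect, normalized]
  have reversible := hρ.isReversible hN α
  refine mergingTime_le_of_faberKrahn reversible (θ := 1 / 3) (by norm_num)
    (fun x => (third_le_baseWalk_self x).trans
      (apply_self_le_metropolis (baseWalk_mem_rowStochastic hN) x))
    one_le_two reflect_involutive (metropolis_apply_perm baseWalk_reflect symm) symm
    reflect_mid (hρ.hasUnitDrift α) (fun x => hitTime_nonneg weight_pos (natAbs_le x))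
    ((one_le_pow₀ (by exact_mod_cast hN)).trans hNG)
    (fun x => (hitTime_mono weight_pos (natAbs_le x)).trans hG) (by positivity)
    (faberKrahnConst_pos α) (mul_pos (volumeConst_pos α) (by positivity))
    ((hρ.faberKrahn hα hN).mono reversible
      (mul_le_mul_of_nonneg_left hNG (faberKrahnConst_pos α).le))
    (fun i hi => isOrbitPerturbation_of_mem_perturbSet hN reversible.stochastic
      (fun y hy => hρ.two_mul_le_metropolis_mid hε hy) (hK i hi)) hη

end IsRadialProfile

end RadialMerging

section HittingTimes

variable {N : ℕ} {u : ℕ → ℝ}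

lemma hitTime_le_of_antitoneOn (hu : ∀ a ≤ N, 0 < u a) (hanti : AntitoneOn u (Set.Iic N)) :
    hitTime u N N ≤ 3 * (N : ℝ) ^ 2 := by
  refine (sum_le_card_nsmul _ _ (3 * N : ℝ) fun a ha => ?_).trans_eq (by
    rw [card_range, nsmul_eq_mul]
    ring)
  have a_lt : a + 1 ≤ N := mem_range.1 ha
  have u_pos := hu (a + 1) a_lt
  have sum_le : ∑ b ∈ Ico (a + 1) (N + 1), u b ≤ N * u (a + 1) := by
    refine (sum_le_card_nsmul _ _ (u (a + 1)) fun b hb => ?_).trans ?_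
    · obtain ⟨le_b, b_lt⟩ := mem_Ico.1 hb
      exact hanti a_lt (Nat.lt_succ_iff.1 b_lt) le_b
    · rw [Nat.card_Ico, nsmul_eq_mul]
      gcongr
      omega
  rw [min_eq_right (hanti (Nat.le_of_succ_le a_lt) a_lt a.le_succ), div_le_iff₀ u_pos]
  linarith

lemma hitTime_le_of_monotoneOn (hu : ∀ a ≤ N, 0 < u a) (hmono : MonotoneOn u (Set.Iic N)) :
    hitTime u N N ≤ 3 * N * u N * ∑ a ∈ range N, (u a)⁻¹ := by
  rw [hitTime, mul_sum]
  refine sum_le_sum fun a ha => ?_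
  have a_lt : a + 1 ≤ N := mem_range.1 ha
  have a_le := Nat.le_of_succ_le a_lt
  have u_pos := hu a a_le
  have sum_le : ∑ b ∈ Ico (a + 1) (N + 1), u b ≤ N * u N := by
    refine (sum_le_card_nsmul _ _ (u N) fun b hb => ?_).trans ?_
    · have b_le := Nat.lt_succ_iff.1 (mem_Ico.1 hb).2
      exact hmono b_le Set.self_mem_Iic b_le
    · have := hu N le_rfl
      rw [Nat.card_Ico, nsmul_eq_mul]
      gcongr
      omega
  rw [min_eq_left (hmono a_le a_lt a.le_succ), ← div_eq_mul_inv, mul_assoc 3 (N : ℝ)]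
  exact div_le_div_of_nonneg_right (mul_le_mul_of_nonneg_left sum_le three_pos.le) u_pos.le

end HittingTimes

section PowerWeights

variable {N : ℕ} {α : ℝ}

lemma piHat_eq_normalized_radialWeight (α : ℝ) (N : ℕ) :
    piHat α N = normalized (radialWeight (fun a => N - a + 1) α) := by
  rw [piHat]
  congr 1 with x
  rw [radialWeight, ← Int.cast_abs, Int.abs_eq_natAbs, Int.cast_natCast]
  push_cast [Nat.cast_sub (natAbs_le x)]
  rfl

lemma piCheck_eq_normalized_radialWeight (α : ℝ) (N : ℕ) :
    piCheck α N = normalized (radialWeight (fun a => a + 1) α) := by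
  rw [piCheck]
  congr 1 with x
  rw [radialWeight, ← Int.cast_abs, Int.abs_eq_natAbs, Int.cast_natCast]
  push_cast
  rfl

lemma six_mul_epsHat_le (hα : 0 ≤ α) (N : ℕ) :
    6 * epsHat α N ≤ min 1 ((N : ℝ) ^ α / ((N : ℝ) + 1) ^ α) := by
  rw [← Real.div_rpow (Nat.cast_nonneg _) (by positivity), epsHat, ← mul_assoc,
    mul_one_div_cancel (by norm_num), one_mul]
  refine le_min (Real.rpow_le_one (by positivity) ?_ hα) le_rfl
  rw [div_le_one (by positivity)]
  linarith

theorem mergingTime_hat_le (hα : 0 ≤ α) (hN : 1 ≤ N) {K : ℕ → Matrix (Vtx N) (Vtx N) ℝ}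
    (hK : DrivenBy (perturbSet (MHat α N) (epsHat α N)) K) {η : ℝ} (hη : 0 < η) :
    (mergingTime K η : ℝ≥0∞) ≤
      ENNReal.ofReal (radialConst α * (3 * (N : ℝ) ^ 2 * (1 + Real.posLog (1 / η)))) := by
  have profile := isRadialProfile_sub_add_one N
  rw [MHat, piHat_eq_normalized_radialWeight] at hK
  refine profile.mergingTime_le hα hN (by nlinarith [sq_nonneg (N : ℝ)])
    (hitTime_le_of_antitoneOn (fun _ => profile.rpow_pos α) fun a _ b _ hab => ?_) ?_ hK hη
  · exact Real.rpow_le_rpow (Nat.cast_nonneg _) (mod_cast by omega) hα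
  · have : N - 1 + 1 = N := Nat.sub_add_cancel hN
    simpa only [this, Nat.sub_zero, Nat.cast_add, Nat.cast_one] using six_mul_epsHat_le hα N

theorem mergingTime_check_le (hα : 0 ≤ α) (hN : 1 ≤ N) {G : ℝ} (hNG : (N : ℝ) ^ 2 ≤ G)
    (hG : 3 * N * (2 * N : ℝ) ^ α * ∑ a ∈ range N, ((a + 1 : ℝ) ^ α)⁻¹ ≤ G)
    {K : ℕ → Matrix (Vtx N) (Vtx N) ℝ} (hK : DrivenBy (perturbSet (MCheck α N) epsCheck) K)
    {η : ℝ} (hη : 0 < η) :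
    (mergingTime K η : ℝ≥0∞) ≤
      ENNReal.ofReal (radialConst α * (G * (1 + Real.posLog (1 / η)))) := by
  have profile := isRadialProfile_add_one N
  rw [MCheck, piCheck_eq_normalized_radialWeight] at hK
  refine profile.mergingTime_le hα hN hNG
    ((hitTime_le_of_monotoneOn (fun _ => profile.rpow_pos α) fun a _ b _ hab => ?_).trans ?_)
    ?_ hK hη
  · exact Real.rpow_le_rpow (Nat.cast_nonneg _) (mod_cast Nat.succ_le_succ hab) hα
  · have one_le : (1 : ℝ) ≤ N := by exact_mod_cast hN
    refine le_trans ?_ hG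
    push_cast
    gcongr
    linarith
  · rw [epsCheck, min_eq_left] <;> norm_num
    exact Real.one_le_rpow one_le_two hα

end PowerWeights

section Rates

variable {α : ℝ}

lemma one_sub_mul_inv_rpow_le (hα0 : 0 ≤ α) (hα1 : α ≤ 1) {x : ℝ} (hx : 1 ≤ x) :
    (1 - α) * (x ^ α)⁻¹ ≤ x ^ (1 - α) - (x - 1) ^ (1 - α) := by
  have x_pos : 0 < x := one_pos.trans_le hx
  have inv_le : x⁻¹ ≤ 1 := inv_le_one_of_one_le₀ hx
  have bernoulli := rpow_one_add_le_one_add_mul_self (s := -x⁻¹) (neg_le_neg inv_le)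
    (sub_nonneg.2 hα1) (sub_le_self 1 hα0)
  calc (1 - α) * (x ^ α)⁻¹ = x ^ (1 - α) - x ^ (1 - α) * (1 + (1 - α) * -x⁻¹) := by
        rw [Real.rpow_sub x_pos, Real.rpow_one]
        field_simp
        ring
    _ ≤ x ^ (1 - α) - x ^ (1 - α) * (1 + -x⁻¹) ^ (1 - α) := by gcongr
    _ = x ^ (1 - α) - (x - 1) ^ (1 - α) := by
        rw [← Real.mul_rpow x_pos.le (by linarith)]
        congr 2
        field_simp
        ring

lemma sum_inv_rpow_le (hα0 : 0 ≤ α) (hα1 : α < 1) (N : ℕ) :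
    ∑ a ∈ range N, ((a + 1 : ℝ) ^ α)⁻¹ ≤ (N : ℝ) ^ (1 - α) / (1 - α) := by
  have one_sub_pos := sub_pos.2 hα1
  rw [le_div_iff₀' one_sub_pos, mul_sum]
  calc ∑ a ∈ range N, (1 - α) * ((a + 1 : ℝ) ^ α)⁻¹
      ≤ ∑ a ∈ range N, (((a + 1 : ℕ) : ℝ) ^ (1 - α) - (a : ℝ) ^ (1 - α)) := by
        refine sum_le_sum fun a _ => ?_
        simpa using one_sub_mul_inv_rpow_le hα0 hα1.le (x := a + 1) (by simp)
    _ = (N : ℝ) ^ (1 - α) := by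
        rw [sum_range_sub (fun a : ℕ => (a : ℝ) ^ (1 - α)), Nat.cast_zero,
          Real.zero_rpow one_sub_pos.ne', sub_zero]

lemma summable_inv_add_one_rpow (hα : 1 < α) : Summable fun a : ℕ => ((a + 1 : ℝ) ^ α)⁻¹ := by
  simpa using (summable_nat_add_iff 1).2 (Real.summable_nat_rpow_inv.2 hα)

lemma one_add_posLog_le {η₀ η : ℝ} (h0 : 0 < η₀) (h1 : η₀ < 1) (hη : 0 < η) (hle : η ≤ η₀) :
    1 + Real.posLog (1 / η) ≤ (1 + 1 / Real.log (1 / η₀)) * Real.posLog (1 / η) := by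
  have log_pos : 0 < Real.log (1 / η₀) := Real.log_pos (one_lt_one_div h0 h1)
  have log_le : Real.log (1 / η₀) ≤ Real.posLog (1 / η) :=
    (Real.log_le_log (by positivity) (one_div_le_one_div_of_le hη hle)).trans (le_max_right _ _)
  rw [one_add_mul, add_comm, one_div_mul_eq_div]
  gcongr
  exact (one_le_div log_pos).2 log_le

lemma mergingTime_check_le_of_le (hα : 0 ≤ α) {N : ℕ} (hN : 1 ≤ N) {C R : ℝ} (hC : 0 ≤ C)
    (hR : 0 ≤ R) (hNR : (N : ℝ) ^ 2 ≤ C * R)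
    (hsum : 3 * N * (2 * N : ℝ) ^ α * ∑ a ∈ range N, ((a + 1 : ℝ) ^ α)⁻¹ ≤ C * R)
    {K : ℕ → Matrix (Vtx N) (Vtx N) ℝ} (hK : DrivenBy (perturbSet (MCheck α N) epsCheck) K)
    {η₀ η : ℝ} (h0 : 0 < η₀) (h1 : η₀ < 1) (hη : 0 < η) (hle : η ≤ η₀) :
    (mergingTime K η : ℝ≥0∞) ≤ ENNReal.ofReal (radialConst α * (C * (1 + 1 / Real.log (1 / η₀)))
      * ((N : ℝ) ^ 2 + R * Real.posLog (1 / η))) := by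
  have const_pos := radialConst_pos hα
  have log_pos : 0 < Real.log (1 / η₀) := Real.log_pos (one_lt_one_div h0 h1)
  refine (mergingTime_check_le hα hN hNR hsum hK hη).trans (ENNReal.ofReal_le_ofReal ?_)
  calc radialConst α * (C * R * (1 + Real.posLog (1 / η)))
      ≤ radialConst α * (C * R * ((1 + 1 / Real.log (1 / η₀)) * Real.posLog (1 / η))) := by
        gcongr
        exact one_add_posLog_le h0 h1 hη hle
    _ = radialConst α * (C * (1 + 1 / Real.log (1 / η₀))) * (R * Real.posLog (1 / η)) := by ring
    _ ≤ _ := by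
        gcongr
        exact le_add_of_nonneg_left (sq_nonneg _)

theorem exists_mergingTime_hat_le (hα : 0 ≤ α) :
    ∃ A : ℝ, 0 < A ∧ ∀ N : ℕ, 1 ≤ N → ∀ K : ℕ → Matrix (Vtx N) (Vtx N) ℝ,
      DrivenBy (perturbSet (MHat α N) (epsHat α N)) K → ∀ η : ℝ, 0 < η →
        (mergingTime K η : ℝ≥0∞) ≤
          ENNReal.ofReal (A * ((N : ℝ) ^ 2 * (1 + Real.posLog (1 / η)))) := by
  refine ⟨radialConst α * 3, mul_pos (radialConst_pos hα) three_pos, fun N hN K hK η hη => ?_⟩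
  convert mergingTime_hat_le hα hN hK hη using 2
  ring

theorem exists_mergingTime_check_le_of_one_lt (hα : 1 < α) {η₀ : ℝ} (h0 : 0 < η₀) (h1 : η₀ < 1) :
    ∃ A : ℝ, 0 < A ∧ ∀ N : ℕ, 1 ≤ N → ∀ K : ℕ → Matrix (Vtx N) (Vtx N) ℝ,
      DrivenBy (perturbSet (MCheck α N) epsCheck) K → ∀ η : ℝ, 0 < η → η ≤ η₀ →
        (mergingTime K η : ℝ≥0∞) ≤
          ENNReal.ofReal (A * ((N : ℝ) ^ 2 + (N : ℝ) ^ (1 + α) * Real.posLog (1 / η))) := by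
  have α_nonneg : 0 ≤ α := zero_le_one.trans hα.le
  have const_pos := radialConst_pos α_nonneg
  have log_pos : 0 < Real.log (1 / η₀) := Real.log_pos (one_lt_one_div h0 h1)
  set S := ∑' a : ℕ, ((a + 1 : ℝ) ^ α)⁻¹
  have : 0 ≤ S := tsum_nonneg fun a => by positivity
  refine ⟨radialConst α * ((1 + 3 * 2 ^ α * S) * (1 + 1 / Real.log (1 / η₀))), by positivity,
    fun N hN K hK η hη hle => mergingTime_check_le_of_le α_nonneg hN (by positivity) (by positivity)
      ?_ ?_ hK h0 h1 hη hle⟩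
  · have one_le : (1 : ℝ) ≤ N := by exact_mod_cast hN
    calc (N : ℝ) ^ 2 = (N : ℝ) ^ (2 : ℝ) := (Real.rpow_two _).symm
      _ ≤ (N : ℝ) ^ (1 + α) := Real.rpow_le_rpow_of_exponent_le one_le (by linarith)
      _ ≤ _ := le_mul_of_one_le_left (by positivity) (le_add_of_nonneg_right (by positivity))
  · calc 3 * N * (2 * N : ℝ) ^ α * ∑ a ∈ range N, ((a + 1 : ℝ) ^ α)⁻¹
        ≤ 3 * N * (2 * N : ℝ) ^ α * S := by
          gcongr
          exact (summable_inv_add_one_rpow hα).sum_le_tsum _ fun a _ => by positivity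
      _ = 3 * 2 ^ α * S * (N : ℝ) ^ (1 + α) := by
          rw [Real.mul_rpow two_pos.le N.cast_nonneg,
            Real.rpow_add' N.cast_nonneg (by positivity), Real.rpow_one]
          ring
      _ ≤ _ := by
          gcongr
          exact le_add_of_nonneg_left zero_le_one

theorem exists_mergingTime_check_one_le {η₀ : ℝ} (h0 : 0 < η₀) (h1 : η₀ < 1) :
    ∃ A : ℝ, 0 < A ∧ ∀ N : ℕ, 2 ≤ N → ∀ K : ℕ → Matrix (Vtx N) (Vtx N) ℝ,
      DrivenBy (perturbSet (MCheck 1 N) epsCheck) K → ∀ η : ℝ, 0 < η → η ≤ η₀ →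
        (mergingTime K η : ℝ≥0∞) ≤
          ENNReal.ofReal (A * ((N : ℝ) ^ 2 + (N : ℝ) ^ 2 * Real.log N * Real.posLog (1 / η))) := by
  have const_pos := radialConst_pos zero_le_one
  have log_pos : 0 < Real.log (1 / η₀) := Real.log_pos (one_lt_one_div h0 h1)
  have log_two_pos : 0 < Real.log 2 := Real.log_pos one_lt_two
  refine ⟨radialConst 1 * (6 * (1 + 1 / Real.log 2) * (1 + 1 / Real.log (1 / η₀))),
    by positivity, fun N hN K hK η hη hle => ?_⟩
  have two_le : (2 : ℝ) ≤ N := by exact_mod_cast hN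
  have log_two_le : Real.log 2 ≤ Real.log N := Real.log_le_log two_pos two_le
  have log_N_pos := log_two_pos.trans_le log_two_le
  have one_add_log_le : 1 + Real.log N ≤ (1 + 1 / Real.log 2) * Real.log N := by
    rw [one_add_mul, add_comm, one_div_mul_eq_div]
    gcongr
    exact (one_le_div log_two_pos).2 log_two_le
  have rate_eq : 6 * (N : ℝ) ^ 2 * ((1 + 1 / Real.log 2) * Real.log N)
      = 6 * (1 + 1 / Real.log 2) * ((N : ℝ) ^ 2 * Real.log N) := by ring
  refine mergingTime_check_le_of_le zero_le_one (by omega) (by positivity) (by positivity)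
    ?_ ?_ hK h0 h1 hη hle
  · rw [← rate_eq]
    nlinarith [sq_nonneg (N : ℝ)]
  · have sum_eq : ∑ a ∈ range N, ((a + 1 : ℝ) ^ (1 : ℝ))⁻¹ = harmonic N := by simp [harmonic]
    calc 3 * N * (2 * N : ℝ) ^ (1 : ℝ) * ∑ a ∈ range N, ((a + 1 : ℝ) ^ (1 : ℝ))⁻¹
        = 6 * (N : ℝ) ^ 2 * harmonic N := by
          rw [sum_eq, Real.rpow_one]
          ring
      _ ≤ 6 * (N : ℝ) ^ 2 * ((1 + 1 / Real.log 2) * Real.log N) := by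
          gcongr
          exact (harmonic_le_one_add_log N).trans one_add_log_le
      _ = _ := rate_eq

theorem exists_mergingTime_check_le_of_lt_one (hα0 : 0 ≤ α) (hα1 : α < 1) :
    ∃ A : ℝ, 0 < A ∧ ∀ N : ℕ, 1 ≤ N → ∀ K : ℕ → Matrix (Vtx N) (Vtx N) ℝ,
      DrivenBy (perturbSet (MCheck α N) epsCheck) K → ∀ η : ℝ, 0 < η →
        (mergingTime K η : ℝ≥0∞) ≤
          ENNReal.ofReal (A * ((N : ℝ) ^ 2 * (1 + Real.posLog (1 / η)))) := by
  have const_pos := radialConst_pos hα0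
  have one_sub_pos := sub_pos.2 hα1
  have ratio_nonneg : 0 ≤ 3 * 2 ^ α / (1 - α) := by positivity
  refine ⟨radialConst α * (1 + 3 * 2 ^ α / (1 - α)), by positivity, fun N hN K hK η hη => ?_⟩
  have N_pos : (0 : ℝ) < N := by exact_mod_cast hN
  rw [mul_assoc, ← mul_assoc (1 + _)]
  refine mergingTime_check_le hα0 hN
    (le_mul_of_one_le_left (sq_nonneg _) (le_add_of_nonneg_right ratio_nonneg)) ?_ hK hη
  calc 3 * N * (2 * N : ℝ) ^ α * ∑ a ∈ range N, ((a + 1 : ℝ) ^ α)⁻¹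
      ≤ 3 * N * (2 * N : ℝ) ^ α * ((N : ℝ) ^ (1 - α) / (1 - α)) := by
        gcongr
        exact sum_inv_rpow_le hα0 hα1 N
    _ = 3 * 2 ^ α / (1 - α) * (N : ℝ) ^ 2 := by
        rw [Real.mul_rpow two_pos.le N_pos.le, Real.rpow_sub N_pos, Real.rpow_one]
        field_simp
    _ ≤ _ := by
        gcongr
        exact le_add_of_nonneg_left zero_le_one

end Rates

end BDMerging

theorem theorem3p2 (α : ℝ) (hα : 0 ≤ α) :
    (∃ A : ℝ, 0 < A ∧ ∀ N : ℕ, 1 ≤ N →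
      ∀ K : ℕ → Matrix (BDMerging.Vtx N) (BDMerging.Vtx N) ℝ,
        (∀ i : ℕ, 1 ≤ i →
          K i ∈ BDMerging.perturbSet (BDMerging.MHat α N) (BDMerging.epsHat α N)) →
        ∀ η : ℝ, 0 < η →
          (BDMerging.mergingTime K η : ℝ≥0∞) ≤
            ENNReal.ofReal (A * ((N : ℝ) ^ 2 * (1 + Real.posLog (1 / η))))) ∧
    (1 < α → ∀ η₀ : ℝ, 0 < η₀ → η₀ < 1 → ∃ A : ℝ, 0 < A ∧ ∀ N : ℕ, 1 ≤ N →
      ∀ K : ℕ → Matrix (BDMerging.Vtx N) (BDMerging.Vtx N) ℝ,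
        (∀ i : ℕ, 1 ≤ i →
          K i ∈ BDMerging.perturbSet (BDMerging.MCheck α N) BDMerging.epsCheck) →
        ∀ η : ℝ, 0 < η → η ≤ η₀ →
          (BDMerging.mergingTime K η : ℝ≥0∞) ≤
            ENNReal.ofReal
              (A * ((N : ℝ) ^ 2 + (N : ℝ) ^ (1 + α) * Real.posLog (1 / η)))) ∧
    (α = 1 → ∀ η₀ : ℝ, 0 < η₀ → η₀ < 1 → ∃ A : ℝ, 0 < A ∧ ∀ N : ℕ, 2 ≤ N →
      ∀ K : ℕ → Matrix (BDMerging.Vtx N) (BDMerging.Vtx N) ℝ,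
        (∀ i : ℕ, 1 ≤ i →
          K i ∈ BDMerging.perturbSet (BDMerging.MCheck α N) BDMerging.epsCheck) →
        ∀ η : ℝ, 0 < η → η ≤ η₀ →
          (BDMerging.mergingTime K η : ℝ≥0∞) ≤
            ENNReal.ofReal
              (A * ((N : ℝ) ^ 2 + (N : ℝ) ^ 2 * Real.log N * Real.posLog (1 / η)))) ∧
    (α < 1 → ∃ A : ℝ, 0 < A ∧ ∀ N : ℕ, 1 ≤ N →
      ∀ K : ℕ → Matrix (BDMerging.Vtx N) (BDMerging.Vtx N) ℝ,
        (∀ i : ℕ, 1 ≤ i →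
          K i ∈ BDMerging.perturbSet (BDMerging.MCheck α N) BDMerging.epsCheck) →
        ∀ η : ℝ, 0 < η →
          (BDMerging.mergingTime K η : ℝ≥0∞) ≤
            ENNReal.ofReal (A * ((N : ℝ) ^ 2 * (1 + Real.posLog (1 / η))))) :=
  ⟨BDMerging.exists_mergingTime_hat_le hα,
    fun hα₁ _ hη₀ hη₁ => BDMerging.exists_mergingTime_check_le_of_one_lt hα₁ hη₀ hη₁,
    fun hα₁ _ hη₀ hη₁ => hα₁ ▸ BDMerging.exists_mergingTime_check_one_le hη₀ hη₁,
    fun hα₁ => BDMerging.exists_mergingTime_check_le_of_lt_one hα hα₁⟩
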